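/- Consider an access point serving two clients $j\in\{1,2\}$ in slots $t=1,2,\dots$ (frame length $\tau=1$). In every slot each client has one fresh packet, and the access point may attempt at most one client; an attempted packet of client $j$ is delivered with probability $p_j\in(0,1]$, independently of everything known before the transmission, and undelivered packets are dropped at the end of the slot. Let $u_j(t)$ and $g_j(t)$ be the indicators that client $j$ is attempted, respectively that a packet of client $j$ is delivered, in slot $t$. Let $(\mathcal F_t)_{t\ge 0}$ be a filtration such that the (possibly randomized, history dependent) choice of the client for slot $t$ is $\mathcal F_{t-1}$-measurable, the deliveries in slot $t$ are $\mathcal F_t$-measurable, and the channel in slot $t$ is independent of $\mathcal F_{t-1}$. Let $q_1,q_2\ge 0$ satisfy $\frac{q_1}{p_1}+\frac{q_2}{p_2}=1$ (heavy traffic). Assume that the policy is non-idling, i.e. almost surely some client is attempted in every slot, and that it fulfils $(q_1,q_2)$, i.e. almost surely $\liminf_{T\to\infty}\frac1T\sum_{t=1}^T g_j(t)\ge q_j$ for $j=1,2$. Put $$m_j(t)=u_j(t)-\frac{1}{p_j}g_j(t),\qquad M_j(t)=\sum_{l=1}^t m_j(l),\qquad \mathcal S_j^2(T)=\sum_{t=1}^T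 E\big(m_j^2(t)\,\big|\,\mathcal F_{t-1}\big),$$ $$v_j=\frac{1-p_j}{p_j},\qquad c_j=\frac{q_j}{p_j}v_j=\frac{q_j(1-p_j)}{p_j^2},\qquad \phi(t)=\sqrt{2t\log\log t}.$$ Then, for $j=1,2$, $M_j$ is a martingale with respect to $(\mathcal F_t)$, and, almost surely, (i) $E(m_j^2(t)\mid\mathcal F_{t-1})=u_j(t)\,v_j$ for every $t\ge 1$; (ii) $\mathcal S_j^2(T)=\sum_{t=1}^T u_j(t)\,v_j$ for every $T$; (iii) $\lim_{T\to\infty}\mathcal S_j^2(T)/T=c_j$; (iv) $\lim_{T\to\infty}\mathcal S_j(T)/\sqrt T=\sqrt{c_j}$, where $\mathcal S_j(T)=\sqrt{\mathcal S_j^2(T)}$. Consequently, almost surely, $\displaystyle\limsup_{t\to\infty}\frac{M_j(t)}{\phi(t)}=\sqrt{c_j}$. -/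

import Mathlib

open MeasureTheory ProbabilityTheory Filter Topology

noncomputable section

/-- An access point serving two clients with frames of one slot, under some scheduling policy.
Slots are numbered `1, 2, 3, …`. In every slot each client has one fresh packet, at most one packet
is transmitted, and a packet for client `j` that is transmitted in slot `t` is delivered exactly
when the channel of client `j` is good in that slot, which has probability `p j`, independently of
everything known before the transmission.

The σ-algebra `ℱ t` is what is known after slot `t` and before the transmission in slot `t + 1`,
including any private randomness that the policy uses to choose the client of slot `t + 1`. -/
structure ScheduledSystem {Ω : Type*} [mΩ : MeasurableSpace Ω] (P : Measure Ω)
    (p : Fin 2 → ℝ) where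
  /-- the information available to the policy -/
  ℱ : Filtration ℕ mΩ
  /-- the client attempted in a slot (`none` if the access point idles) -/
  serve : ℕ → Ω → Option (Fin 2)
  /-- the event that the channel of a client is good in a slot -/
  good : ℕ → Fin 2 → Set Ω
  /-- the choice for slot `t + 1` is made on the basis of `ℱ t` -/
  serve_predictable : ∀ t j, MeasurableSet[ℱ t] {ω | serve (t + 1) ω = some j}
  good_measurable : ∀ t j, MeasurableSet (good (t + 1) j)
  good_prob : ∀ t j, P (good (t + 1) j) = ENNReal.ofReal (p j)
  /-- the channel in slot `t + 1` is independent of what is known before that transmission -/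
  good_indep : ∀ t j B, MeasurableSet[ℱ t] B → IndepSet (good (t + 1) j) B P
  /-- after slot `t + 1` it is known whether a packet has been delivered in it -/
  delivery_observed : ∀ t j,
    MeasurableSet[ℱ (t + 1)] ({ω | serve (t + 1) ω = some j} ∩ good (t + 1) j)

namespace ScheduledSystem

variable {Ω : Type*} [mΩ : MeasurableSpace Ω] {P : Measure Ω} {p : Fin 2 → ℝ}

/-- `u_j(t)`: the indicator that client `j` is attempted in slot `t`. -/
def u (S : ScheduledSystem P p) (j : Fin 2) (t : ℕ) : Ω → ℝ :=
  {ω | S.serve t ω = some j}.indicator 1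

/-- `g_j(t)`: the indicator that a packet of client `j` is delivered in slot `t`. -/
def g (S : ScheduledSystem P p) (j : Fin 2) (t : ℕ) : Ω → ℝ :=
  ({ω | S.serve t ω = some j} ∩ S.good t j).indicator 1

/-- `m_j(t) = u_j(t) - g_j(t) / p_j`. -/
def m (S : ScheduledSystem P p) (j : Fin 2) (t : ℕ) (ω : Ω) : ℝ :=
  S.u j t ω - (1 / p j) * S.g j t ω

/-- `M_j(t) = ∑_{l=1}^t m_j(l)`. -/
def M (S : ScheduledSystem P p) (j : Fin 2) (t : ℕ) (ω : Ω) : ℝ :=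
  ∑ l ∈ Finset.Icc 1 t, S.m j l ω

/-- `S_j²(T) = ∑_{t=1}^T E[m_j(t)² | ℱ_{t-1}]`, the conditional variance sum. -/
def condVarSum (S : ScheduledSystem P p) (j : Fin 2) (T : ℕ) (ω : Ω) : ℝ :=
  ∑ t ∈ Finset.Icc 1 T, (P[fun ω' => S.m j t ω' ^ 2 | S.ℱ (t - 1)]) ω

/-- Each client has a fresh packet in every slot, so a policy is non-idling exactly when it attempts
some client in every slot. -/
def NonIdling (S : ScheduledSystem P p) : Prop :=
  ∀ t, 1 ≤ t → ∀ᵐ ω ∂P, S.serve t ω ≠ none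

/-- Almost surely, the timely throughput of each client `j` is at least `q j`. -/
def Fulfils (S : ScheduledSystem P p) (q : Fin 2 → ℝ) : Prop :=
  ∀ j, ∀ᵐ ω ∂P, q j ≤ liminf (fun T : ℕ => (∑ t ∈ Finset.Icc 1 T, S.g j t ω) / (T : ℝ)) atTop

end ScheduledSystem

/-- `φ(t) = √(2 t log log t)`. -/
def lilScale (t : ℕ) : ℝ := Real.sqrt (2 * t * Real.log (Real.log t))

end

/-! Given the past, `m_j(t)` vanishes if client `j` is not attempted, and otherwise is distributed
like `1 - B / p_j` with `B` Bernoulli of mean `p_j`: mean zero, variance `v = (1 - p_j) / p_j`.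
Hence `M_j` is a martingale whose conditional variance sum is `v` times the number `N_j` of
attempts, and everything reduces to the growth of `N_j` and to a law of the iterated logarithm on
the clock `N_j`.

Upper half (`ae_eventually_mul_M_le`): `exp (r M_j) / L(r) ^ N_j`, with `L` the moment generating
function of one step, is a nonnegative martingale. Ville's inequality over geometric blocks of time
and the first Borel–Cantelli lemma bound `M_j` and `-M_j`.

Growth of `N_j` (`ae_tendsto_attempts_div`): since `N_j(t) ≤ t`, the upper half already gives
`M_j(t) / t → 0`, so attempts and deliveries have proportional frequencies and `liminf N_j(t) / t ≥
q_j / p_j`. Without idling the two frequencies sum to one, as do the two lower bounds under heavy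
traffic; so both are limits.

Lower half (`ae_frequently_mul_lilScale_le_M`): if `N_j → ∞`, the outcomes of the successive
attempts are independent, and `M_j(t)` is a random walk with i.i.d. steps observed at time `N_j(t)`.
The walk obeys the classical lower half (moderate deviations, independent blocks, second
Borel–Cantelli lemma), which is carried back through `N_j(t) ∼ (q_j / p_j) t`. -/

/-! ### Expansion of the moment generating function of one step -/

/-- The moment generating function of `1 - B / p`, where `B` is a Bernoulli variable of mean `p`. -/
noncomputable def attemptMGF (p s : ℝ) : ℝ := p * Real.exp (s * (1 - 1 / p)) + (1 - p) * Real.exp s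

lemma attemptMGF_pos {p : ℝ} (h0 : 0 < p) (h1 : p ≤ 1) (s : ℝ) : 0 < attemptMGF p s := by
  have h := mul_pos h0 (Real.exp_pos (s * (1 - 1 / p)))
  have h' := mul_nonneg (sub_nonneg.2 h1) (Real.exp_pos s).le
  unfold attemptMGF
  linarith

lemma abs_exp_sub_quadratic_le {x : ℝ} (hx : |x| ≤ 1) :
    |Real.exp x - (1 + x + x ^ 2 / 2)| ≤ |x| ^ 3 := by
  have h := Real.exp_bound hx (n := 3) (by norm_num)
  have e : ∑ m ∈ Finset.range 3, x ^ m / (m.factorial : ℝ) = 1 + x + x ^ 2 / 2 := by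
    simp [Finset.sum_range_succ]
  rw [e] at h
  refine h.trans ?_
  have : 0 ≤ |x| ^ 3 := by positivity
  norm_num [Nat.factorial]
  linarith

/-- Second order expansion of `attemptMGF` at zero. -/
lemma exists_abs_attemptMGF_sub_le {p : ℝ} (h0 : 0 < p) (h1 : p ≤ 1) :
    ∃ C, 0 ≤ C ∧ ∀ᶠ s in 𝓝 (0 : ℝ),
      |attemptMGF p s - (1 + s ^ 2 * ((1 - p) / p) / 2)| ≤ C * |s| ^ 3 := by
  refine ⟨|1 - 1 / p| ^ 3 + 1, by positivity, ?_⟩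
  have e1 : ∀ᶠ s in 𝓝 (0 : ℝ), |s| < 1 :=
    continuous_abs.continuousAt.eventually_lt continuousAt_const (by simp)
  have e2 : ∀ᶠ s in 𝓝 (0 : ℝ), |s * (1 - 1 / p)| < 1 :=
    ContinuousAt.eventually_lt (by fun_prop) continuousAt_const (by simp)
  filter_upwards [e1, e2] with s hs hs'
  have a1 := abs_exp_sub_quadratic_le hs.le
  have a2 := abs_exp_sub_quadratic_le hs'.le
  -- The step has mean `0` and variance `(1 - p) / p`, so only the cubic remainders of the two
  -- exponentials survive.
  have key : attemptMGF p s - (1 + s ^ 2 * ((1 - p) / p) / 2)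
      = p * (Real.exp (s * (1 - 1 / p)) - (1 + s * (1 - 1 / p) + (s * (1 - 1 / p)) ^ 2 / 2))
        + (1 - p) * (Real.exp s - (1 + s + s ^ 2 / 2)) := by
    unfold attemptMGF
    field_simp
    ring
  rw [key]
  refine (abs_add_le _ _).trans ?_
  rw [abs_mul, abs_mul, abs_of_pos h0, abs_of_nonneg (sub_nonneg.2 h1)]
  rw [abs_mul s, mul_pow |s|] at a2
  have b1 : (1 - p) * |Real.exp s - (1 + s + s ^ 2 / 2)| ≤ 1 * |s| ^ 3 :=
    mul_le_mul (by linarith) a1 (abs_nonneg _) zero_le_one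
  have b2 := mul_le_mul h1 a2 (abs_nonneg _) zero_le_one
  linarith

/-- Near zero the cubic error is below `η s ^ 2 / 2`; then `1 + x ≤ exp x`. -/
lemma eventually_attemptMGF_le {p η : ℝ} (h0 : 0 < p) (h1 : p ≤ 1) (hη : 0 < η) :
    ∀ᶠ s in 𝓝 (0 : ℝ), attemptMGF p s ≤ Real.exp (s ^ 2 * ((1 - p) / p + η) / 2) := by
  obtain ⟨C, hC, h⟩ := exists_abs_attemptMGF_sub_le h0 h1
  have e : ∀ᶠ s in 𝓝 (0 : ℝ), C * |s| < η / 2 :=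
    ContinuousAt.eventually_lt (by fun_prop) continuousAt_const (by simpa using hη)
  filter_upwards [h, e] with s hs hs'
  have := (abs_le.1 hs).2
  have h3 : C * |s| ^ 3 ≤ η / 2 * s ^ 2 := by
    rw [← sq_abs s]
    nlinarith [mul_le_mul_of_nonneg_right hs'.le (sq_nonneg |s|)]
  have := Real.add_one_le_exp (s ^ 2 * ((1 - p) / p + η) / 2)
  linarith

/-- Same comparison from below, now with `exp x ≤ 1 + x + x ^ 2`; the extra `x ^ 2` is of order `s ^
4`. -/
lemma eventually_le_attemptMGF {p η : ℝ} (h0 : 0 < p) (h1 : p ≤ 1) (hη : 0 < η) :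
    ∀ᶠ s in 𝓝 (0 : ℝ), Real.exp (s ^ 2 * ((1 - p) / p - η) / 2) ≤ attemptMGF p s := by
  obtain ⟨C, hC, h⟩ := exists_abs_attemptMGF_sub_le h0 h1
  set w := ((1 - p) / p - η) / 2 with hw
  have e : ∀ᶠ s in 𝓝 (0 : ℝ), C * |s| + |s| * |s| * w ^ 2 < η / 2 :=
    ContinuousAt.eventually_lt (by fun_prop) continuousAt_const (by simpa using hη)
  have e' : ∀ᶠ s in 𝓝 (0 : ℝ), |s ^ 2 * w| < 1 :=
    ContinuousAt.eventually_lt (by fun_prop) continuousAt_const (by simp)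
  filter_upwards [h, e, e'] with s hs hs' hs''
  have := (abs_le.1 hs).1
  have h3 : C * |s| ^ 3 + (s ^ 2 * w) ^ 2 ≤ η / 2 * s ^ 2 := by
    have := mul_le_mul_of_nonneg_right hs'.le (sq_nonneg |s|)
    rw [← sq_abs s]
    nlinarith
  have h4 := (abs_le.1 (Real.abs_exp_sub_one_sub_id_le hs''.le)).2
  rw [show s ^ 2 * ((1 - p) / p - η) / 2 = s ^ 2 * w by rw [hw]; ring]
  have : s ^ 2 * w = s ^ 2 * ((1 - p) / p) / 2 - η / 2 * s ^ 2 := by rw [hw]; ring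
  linarith

/-! ### Moderate deviation bounds -/

section TailBounds

variable {Ω : Type*} [mΩ : MeasurableSpace Ω]

/-- Chernoff bound for the lower tail at moderate deviations. -/
lemma exists_measureReal_le_neg_le {p : ℝ} (h0 : 0 < p) (h1 : p < 1) :
    ∃ s₀ > 0, ∀ (m : ℕ) (s : ℝ), 0 < s → s < s₀ →
      ∀ (P : Measure Ω) [IsProbabilityMeasure P] (X : Ω → ℝ),
      (∀ r, Integrable (fun ω => Real.exp (r * X ω)) P) → (∀ r, mgf X P r = attemptMGF p r ^ m) →
      P.real {ω | X ω ≤ -(2 * (s * m * ((1 - p) / p)))} ≤ Real.exp (-(m * s ^ 2 * ((1 - p) / p))) := by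
  have hv : 0 < (1 - p) / p := div_pos (by linarith) h0
  -- Taking `η = v` doubles the variance; the Chernoff exponent at `-s` is then `-2 m s² v + m s²
  -- v`.
  obtain ⟨s₀, hs₀, h⟩ := Metric.eventually_nhds_iff.1 (eventually_attemptMGF_le h0 h1.le hv)
  refine ⟨s₀, hs₀, fun m s hs hss P _ X hint hmgf => ?_⟩
  have hc := measure_le_le_exp_mul_mgf (μ := P) (X := X) (t := -s)
    (-(2 * (s * m * ((1 - p) / p)))) (by linarith) (hint _)
  refine hc.trans ?_
  rw [hmgf]
  have hb := pow_le_pow_left₀ (attemptMGF_pos h0 h1.le _).le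
    (h (y := -s) (by simpa [abs_of_pos hs] using hss)) m
  refine (mul_le_mul_of_nonneg_left hb (Real.exp_pos _).le).trans ?_
  rw [← Real.exp_nat_mul, ← Real.exp_add]
  apply Real.exp_le_exp.2
  apply le_of_eq
  ring

/-- Splitting an exponential moment at the levels `(1 - δ) x` and `(1 + δ) x`. -/
lemma mgf_le_add_add {P : Measure Ω} [IsProbabilityMeasure P] {X : Ω → ℝ} {δ s x : ℝ}
    (hδ : 0 < δ) (hs : 0 < s) (hX : Measurable X)
    (hint : ∀ r, Integrable (fun ω => Real.exp (r * X ω)) P) :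
    mgf X P s ≤ mgf X P ((1 - δ) * s) * Real.exp (δ * s * ((1 - δ) * x))
      + Real.exp (s * ((1 + δ) * x)) * P.real {ω | (1 - δ) * x ≤ X ω}
      + mgf X P ((1 + δ) * s) * Real.exp (-(δ * s * ((1 + δ) * x))) := by
  set A := {ω | (1 - δ) * x ≤ X ω} with hA
  have hAm : MeasurableSet A := measurableSet_le measurable_const hX
  have i1 := (hint ((1 - δ) * s)).mul_const (Real.exp (δ * s * ((1 - δ) * x)))
  have i2 : Integrable (fun ω => Real.exp (s * ((1 + δ) * x)) * A.indicator (1 : Ω → ℝ) ω) P :=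
    ((integrable_const (1 : ℝ)).indicator hAm).const_mul _
  have i3 := (hint ((1 + δ) * s)).mul_const (Real.exp (-(δ * s * ((1 + δ) * x))))
  have hA1 : ∫ ω, A.indicator (1 : Ω → ℝ) ω ∂P = P.real A := integral_indicator_one hAm
  calc mgf X P s = ∫ ω, Real.exp (s * X ω) ∂P := rfl
    _ ≤ ∫ ω, (Real.exp ((1 - δ) * s * X ω) * Real.exp (δ * s * ((1 - δ) * x))
        + Real.exp (s * ((1 + δ) * x)) * A.indicator (1 : Ω → ℝ) ω
        + Real.exp ((1 + δ) * s * X ω) * Real.exp (-(δ * s * ((1 + δ) * x)))) ∂P := by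
      -- Pointwise, the first term dominates below `(1 - δ) x`, the second between the levels, the
      -- third above `(1 + δ) x`.
      refine integral_mono (hint s) ((i1.add i2).add i3) fun ω => ?_
      simp only [← Real.exp_add]
      have p1 := Real.exp_pos ((1 - δ) * s * X ω + δ * s * ((1 - δ) * x))
      have p3 := Real.exp_pos ((1 + δ) * s * X ω + -(δ * s * ((1 + δ) * x)))
      have p2 := Real.exp_pos (s * ((1 + δ) * x))
      by_cases c1 : (1 - δ) * x ≤ X ω
      · have hi : A.indicator (1 : Ω → ℝ) ω = 1 := Set.indicator_of_mem (s := A) c1 _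
        rw [hi]
        by_cases c2 : X ω ≤ (1 + δ) * x
        · have := Real.exp_le_exp.2 (mul_le_mul_of_nonneg_left c2 hs.le)
          linarith
        · have : Real.exp (s * X ω)
              ≤ Real.exp ((1 + δ) * s * X ω + -(δ * s * ((1 + δ) * x))) := by
            apply Real.exp_le_exp.2
            nlinarith [mul_le_mul_of_nonneg_left (not_le.1 c2).le (mul_pos hδ hs).le]
          linarith
      · have hi : A.indicator (1 : Ω → ℝ) ω = 0 := Set.indicator_of_notMem (s := A) c1 _
        rw [hi]
        have : Real.exp (s * X ω) ≤ Real.exp ((1 - δ) * s * X ω + δ * s * ((1 - δ) * x)) := by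
          apply Real.exp_le_exp.2
          nlinarith [mul_le_mul_of_nonneg_left (not_le.1 c1).le (mul_pos hδ hs).le]
        linarith
    _ = _ := by
      have e1 := integral_add (i1.add i2) i3
      have e2 := integral_add i1 i2
      simp only [Pi.add_apply] at e1 e2
      rw [e1, e2, integral_mul_const, integral_mul_const, integral_const_mul, hA1]
      rfl

/-- Lower bound for the upper tail at moderate deviations. -/
lemma exists_le_measureReal_ge {p δ : ℝ} (h0 : 0 < p) (h1 : p < 1) (hδ : 0 < δ) (hδ' : δ < 1 / 2) :
    ∃ s₀ > 0, ∃ R : ℝ, ∀ (m : ℕ) (s : ℝ), 0 < s → s < s₀ → R ≤ m * s ^ 2 →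
      ∀ (P : Measure Ω) [IsProbabilityMeasure P] (X : Ω → ℝ), Measurable X →
      (∀ r, Integrable (fun ω => Real.exp (r * X ω)) P) → (∀ r, mgf X P r = attemptMGF p r ^ m) →
      1 / 2 * Real.exp (-((1 + 3 * δ) * (m * s ^ 2 * ((1 - p) / p) / 2)))
        ≤ P.real {ω | (1 - δ) * (s * m * ((1 - p) / p)) ≤ X ω} := by
  set v := (1 - p) / p with hvdef
  have hv : 0 < v := div_pos (by linarith) h0
  have hη : 0 < δ ^ 2 / 8 * v := by positivity
  obtain ⟨s₁, hs₁, hU⟩ := Metric.eventually_nhds_iff.1 (eventually_attemptMGF_le h0 h1.le hη)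
  obtain ⟨s₂, hs₂, hL⟩ := Metric.eventually_nhds_iff.1 (eventually_le_attemptMGF h0 h1.le hη)
  -- The tilts go up to `(1 + δ) s < 2 s`, whence `s₁ / 2`. The bound on `m s²` makes `exp (-y δ² /
  -- 2) ≤ 1 / 4`, so that the outer pieces take at most half of the lower bound for the moment
  -- generating function.
  refine ⟨min (s₁ / 2) s₂, by positivity, 2 * (2 * Real.log 4 / δ ^ 2) / v, ?_⟩
  intro m s hs hs0 hR P _ X hX hint hmgf
  have hs1 : s < s₁ / 2 := hs0.trans_le (min_le_left _ _)
  have hs2 : s < s₂ := hs0.trans_le (min_le_right _ _)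
  set y := m * s ^ 2 * v / 2 with hy
  set x := s * m * v with hx
  have hsx : s * x = 2 * y := by rw [hx, hy]; ring
  have hyR : 2 * Real.log 4 / δ ^ 2 ≤ y := by
    rw [div_le_iff₀ hv] at hR
    linarith
  have hy0 : 0 ≤ y := by positivity
  have up : ∀ r, 0 < r → r < 2 → mgf X P (r * s) ≤ Real.exp (y * (r ^ 2 * (1 + δ ^ 2 / 8))) := by
    intro r hr hr2
    rw [hmgf]
    have hb := pow_le_pow_left₀ (attemptMGF_pos h0 h1.le _).le
      (hU (y := r * s) (by
        simp only [dist_zero_right, Real.norm_eq_abs, abs_of_pos (mul_pos hr hs)]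
        nlinarith)) m
    refine hb.trans (le_of_eq ?_)
    rw [← Real.exp_nat_mul, hy]
    congr 1
    ring
  have lo : Real.exp (y * (1 - δ ^ 2 / 8)) ≤ mgf X P s := by
    rw [hmgf]
    have hb := pow_le_pow_left₀ (Real.exp_pos _).le
      (hL (y := s) (by simpa [abs_of_pos hs] using hs2)) m
    refine le_trans (le_of_eq ?_) hb
    rw [← Real.exp_nat_mul, hy]
    congr 1
    ring
  set A := {ω | (1 - δ) * x ≤ X ω} with hA
  have split := mgf_le_add_add (P := P) (x := x) hδ hs hX hint
  rw [← hA] at split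
  have q0 : Real.exp (-(y * (δ ^ 2 / 2))) ≤ 1 / 4 := by
    have : Real.exp (-(y * (δ ^ 2 / 2))) ≤ Real.exp (-Real.log 4) := by
      apply Real.exp_le_exp.2
      rw [div_le_iff₀ (by positivity)] at hyR
      linarith
    rwa [Real.exp_neg (Real.log 4), Real.exp_log (by norm_num), inv_eq_one_div] at this
  -- Since `(1 ∓ δ)² ± 2 δ (1 ∓ δ) = 1 - δ²`, both outer pieces fall short of the main exponent by
  -- `δ² y`, which exceeds the errors due to `η`.
  have q1 : mgf X P ((1 - δ) * s) * Real.exp (δ * s * ((1 - δ) * x))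
      ≤ 1 / 4 * Real.exp (y * (1 - δ ^ 2 / 8)) := by
    refine (mul_le_mul_of_nonneg_right (up _ (by linarith) (by linarith)) (Real.exp_pos _).le).trans
      (le_trans ?_ (mul_le_mul_of_nonneg_right q0 (Real.exp_pos _).le))
    rw [← Real.exp_add, ← Real.exp_add]
    apply Real.exp_le_exp.2
    rw [show δ * s * ((1 - δ) * x) = y * (2 * δ * (1 - δ)) by linear_combination δ * (1 - δ) * hsx,
      ← mul_add, ← mul_neg, ← mul_add]
    apply mul_le_mul_of_nonneg_left _ hy0
    nlinarith [mul_pos hδ hδ, mul_pos (mul_pos hδ hδ) hδ, mul_pos (mul_pos hδ hδ) (sub_pos.2 hδ')]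
  have q3 : mgf X P ((1 + δ) * s) * Real.exp (-(δ * s * ((1 + δ) * x)))
      ≤ 1 / 4 * Real.exp (y * (1 - δ ^ 2 / 8)) := by
    refine (mul_le_mul_of_nonneg_right (up _ (by linarith) (by linarith)) (Real.exp_pos _).le).trans
      (le_trans ?_ (mul_le_mul_of_nonneg_right q0 (Real.exp_pos _).le))
    rw [← Real.exp_add, ← Real.exp_add]
    apply Real.exp_le_exp.2
    rw [show -(δ * s * ((1 + δ) * x)) = y * (-(2 * δ * (1 + δ))) by
        linear_combination -δ * (1 + δ) * hsx, ← mul_add y, ← mul_neg y, ← mul_add y]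
    apply mul_le_mul_of_nonneg_left _ hy0
    have : (1 + δ) ^ 2 ≤ 9 / 4 := by nlinarith
    nlinarith [mul_le_mul_of_nonneg_left this (sq_nonneg δ)]
  have q2 : 1 / 2 * Real.exp (y * (1 - δ ^ 2 / 8)) ≤ Real.exp (2 * y * (1 + δ)) * P.real A := by
    rw [show s * ((1 + δ) * x) = 2 * y * (1 + δ) by linear_combination (1 + δ) * hsx] at split
    linarith
  have q4 : 1 / 2 * (Real.exp (y * (1 - δ ^ 2 / 8)) * Real.exp (-(2 * y * (1 + δ)))) ≤ P.real A := by
    have := mul_le_mul_of_nonneg_right q2 (Real.exp_pos (-(2 * y * (1 + δ)))).le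
    rw [mul_right_comm (Real.exp _) (P.real A), ← Real.exp_add, add_neg_cancel, Real.exp_zero] at this
    linarith
  refine le_trans ?_ q4
  rw [← Real.exp_add]
  apply mul_le_mul_of_nonneg_left _ (by norm_num)
  apply Real.exp_le_exp.2
  nlinarith [mul_nonneg hy0 (mul_pos hδ (sub_pos.2 hδ')).le, mul_nonneg hy0 hδ.le]

end TailBounds

/-! ### Independence of blocks and Borel–Cantelli series -/

/-- Peeling off the largest index of a finite intersection shows that independence from earlier
events suffices. -/
lemma iIndepSet_of_forall_lt {Ω : Type*} [mΩ : MeasurableSpace Ω] {P : Measure Ω}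
    [IsProbabilityMeasure P] {E : ℕ → Set Ω} (hE : ∀ k, MeasurableSet (E k))
    (h : ∀ (k : ℕ) (s : Finset ℕ), (∀ i ∈ s, i < k) →
      P (E k ∩ ⋂ i ∈ s, E i) = P (E k) * P (⋂ i ∈ s, E i)) : iIndepSet E P := by
  rw [iIndepSet_iff_meas_biInter hE]
  intro s
  induction s using Finset.induction_on_max with
  | empty => simp
  | insert k s hk ih =>
    have hn : k ∉ s := fun hks => lt_irrefl _ (hk k hks)
    rw [Finset.prod_insert hn, Finset.set_biInter_insert, h k s hk, ih]

/-- Events about the sums of an independent sequence over successive blocks are independent. -/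
lemma iIndepSet_le_sum_Ico {Ω : Type*} [mΩ : MeasurableSpace Ω] {P : Measure Ω}
    [IsProbabilityMeasure P] {f : ℕ → Ω → ℝ} (hf : ∀ i, Measurable (f i)) (hind : iIndepFun f P)
    {n : ℕ → ℕ} (hn : Monotone n) (x : ℕ → ℝ) :
    iIndepSet (fun k => {ω | x k ≤ ∑ i ∈ Finset.Ico (n k) (n (k + 1)), f i ω}) P := by
  have block : ∀ (S : Set ℕ) k, (∀ i ∈ Finset.Ico (n k) (n (k + 1)), i ∈ S) →
      MeasurableSet[⨆ i ∈ S, MeasurableSpace.comap (f i) inferInstance]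
        {ω | x k ≤ ∑ i ∈ Finset.Ico (n k) (n (k + 1)), f i ω} := by
    intro S k hS
    refine measurableSet_le measurable_const (Finset.measurable_sum _ fun i hi => ?_)
    have : MeasurableSpace.comap (f i) inferInstance
        ≤ ⨆ i ∈ S, MeasurableSpace.comap (f i) inferInstance :=
      le_iSup₂_of_le i (hS i hi) le_rfl
    exact (comap_measurable (f i)).mono this le_rfl
  refine iIndepSet_of_forall_lt
    (fun k => measurableSet_le measurable_const (Finset.measurable_sum _ fun i _ => hf i))
    fun k s hs => ?_
  -- Block `k` uses indices from `n k` on; every earlier block ends by `n k`.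
  have hI := indep_iSup_of_disjoint (fun i => (hf i).comap_le) hind
    (S := Set.Ici (n k)) (T := Set.Iio (n k))
    (Set.disjoint_left.2 fun i hi hi' => absurd (show i < n k from hi') (not_lt.2 hi))
  rw [Indep_iff] at hI
  refine hI _ _ (block _ k fun i hi => (Finset.mem_Ico.1 hi).1) ?_
  refine Finset.measurableSet_biInter _ fun j hj => block _ j fun i hi => ?_
  exact (Finset.mem_Ico.1 hi).2.trans_le (hn (hs j hj))

lemma tsum_measure_eq_top {Ω : Type*} [mΩ : MeasurableSpace Ω] {P : Measure Ω} {E : ℕ → Set Ω}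
    {c : ℝ} (hc : 0 < c) (h : ∀ᶠ k : ℕ in atTop, c * (1 / ((k : ℝ) + 1)) ≤ P.real (E k)) :
    ∑' k, P (E k) = ⊤ := by
  by_contra hne
  have hs : Summable fun k => P.real (E k) := ENNReal.summable_toReal hne
  have h1 : Summable fun k : ℕ => c * (1 / ((k : ℝ) + 1)) := by
    refine Summable.of_norm_bounded_eventually_nat hs ?_
    filter_upwards [h] with k hk
    rwa [Real.norm_of_nonneg (by positivity)]
  have h2 := (summable_mul_left_iff hc.ne').1 h1
  have h3 : Summable fun k : ℕ => 1 / ((k + 1 : ℕ) : ℝ) := by simpa using h2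
  exact Real.not_summable_one_div_natCast ((summable_nat_add_iff 1).1 h3)

lemma tsum_measure_ne_top {Ω : Type*} [mΩ : MeasurableSpace Ω] {P : Measure Ω}
    [IsFiniteMeasure P] {E : ℕ → Set Ω} {b : ℕ → ℝ} (hb : Summable b)
    (h : ∀ᶠ k : ℕ in atTop, P.real (E k) ≤ b k) : ∑' k, P (E k) ≠ ⊤ := by
  have hs : Summable fun k => P.real (E k) := by
    refine Summable.of_norm_bounded_eventually_nat hb ?_
    filter_upwards [h] with k hk
    rwa [Real.norm_of_nonneg measureReal_nonneg]
  have := hs.tsum_ofReal_ne_top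
  simpa [ofReal_measureReal] using this

/-! ### Lower half of the law of the iterated logarithm for Bernoulli walks -/

section Bernoulli

variable {Ω : Type*} [mΩ : MeasurableSpace Ω] {P : Measure Ω} [IsProbabilityMeasure P]
  {p : ℝ} {G : ℕ → Set Ω}

/-- The centred and scaled indicator `1 - 1_G / p`. -/
noncomputable def attemptStep (p : ℝ) (A : Set Ω) (ω : Ω) : ℝ := 1 - 1 / p * A.indicator 1 ω

lemma measurable_attemptStep {A : Set Ω} (hA : MeasurableSet A) :
    Measurable (attemptStep p A) :=
  measurable_const.sub (measurable_const.mul (measurable_one.indicator hA))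

omit mΩ in
lemma exp_mul_attemptStep (p r : ℝ) (A : Set Ω) (ω : Ω) :
    Real.exp (r * attemptStep p A ω)
      = Real.exp r + A.indicator 1 ω * (Real.exp (r * (1 - 1 / p)) - Real.exp r) := by
  unfold attemptStep
  by_cases h : ω ∈ A <;> simp [h]

lemma integrable_exp_mul_attemptStep (r : ℝ) {A : Set Ω} (hA : MeasurableSet A) :
    Integrable (fun ω => Real.exp (r * attemptStep p A ω)) P := by
  simp only [exp_mul_attemptStep]
  exact (integrable_const _).add (((integrable_const (1 : ℝ)).indicator hA).mul_const _)

lemma mgf_attemptStep (hp : 0 ≤ p) (r : ℝ) {A : Set Ω} (hA : MeasurableSet A)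
    (hPA : P A = ENNReal.ofReal p) : mgf (attemptStep p A) P r = attemptMGF p r := by
  have hr : P.real A = p := by rw [measureReal_def, hPA, ENNReal.toReal_ofReal hp]
  have i2 : Integrable (fun ω => A.indicator (1 : Ω → ℝ) ω *
      (Real.exp (r * (1 - 1 / p)) - Real.exp r)) P :=
    ((integrable_const (1 : ℝ)).indicator hA).mul_const _
  have hA1 : ∫ ω, A.indicator (1 : Ω → ℝ) ω ∂P = p := (integral_indicator_one hA).trans hr
  unfold mgf attemptMGF
  simp only [exp_mul_attemptStep]
  rw [integral_add (integrable_const _) i2, integral_mul_const, hA1]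
  simp
  ring

omit [IsProbabilityMeasure P] in
lemma iIndepFun_attemptStep (hind : iIndepSet G P) : iIndepFun (fun i => attemptStep p (G i)) P := by
  have h := hind.iIndepFun_indicator (β := ℝ) (m := inferInstance)
  exact h.comp (fun _ x => 1 - 1 / p * x) fun _ => by fun_prop

lemma integrable_exp_mul_sum_attemptStep (hG : ∀ i, MeasurableSet (G i)) (hind : iIndepSet G P)
    (s : Finset ℕ) (r : ℝ) :
    Integrable (fun ω => Real.exp (r * ∑ i ∈ s, attemptStep p (G i) ω)) P := by
  have := (iIndepFun_attemptStep (p := p) hind).integrable_exp_mul_sum (t := r) (s := s)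
    (fun i => measurable_attemptStep (hG i)) fun i _ => integrable_exp_mul_attemptStep r (hG i)
  simpa using this

lemma mgf_sum_attemptStep (hp : 0 ≤ p) (hG : ∀ i, MeasurableSet (G i)) (hind : iIndepSet G P)
    (hPG : ∀ i, P (G i) = ENNReal.ofReal p) (s : Finset ℕ) (r : ℝ) :
    mgf (fun ω => ∑ i ∈ s, attemptStep p (G i) ω) P r = attemptMGF p r ^ s.card := by
  have := (iIndepFun_attemptStep (p := p) hind).mgf_sum (t := r)
    (fun i => measurable_attemptStep (hG i)) s
  rw [Finset.prod_congr rfl fun i _ => mgf_attemptStep hp r (hG i) (hPG i),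
    Finset.prod_const] at this
  rw [← this]
  congr 1
  ext ω
  simp

/-- The block constants in the lower half of the law of the iterated logarithm. -/
lemma exists_block_constants {a v : ℝ} (ha : a < Real.sqrt v) :
    ∃ (δ : ℝ) (K : ℕ), 0 < δ ∧ δ < 1 / 2 ∧ 2 ≤ K ∧
      0 ≤ (1 - δ) * Real.sqrt ((1 - 1 / K) / (1 + 3 * δ)) - 2 / Real.sqrt K ∧
      a * Real.sqrt (1 + δ) ≤
        Real.sqrt v * ((1 - δ) * Real.sqrt ((1 - 1 / K) / (1 + 3 * δ)) - 2 / Real.sqrt K) := by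
  -- `f` lets one variable stand for both `δ` and `1 / K`; it is continuous at `0` with `f 0 = 1`,
  -- and underestimates the constant once `1 / K ≤ δ`.
  set f : ℝ → ℝ := fun x => (1 - x) * Real.sqrt ((1 - x) / (1 + 3 * x)) - 2 * Real.sqrt x with hf
  have hfc : ContinuousAt f 0 := by
    have : ContinuousAt (fun x : ℝ => (1 - x) / (1 + 3 * x)) 0 :=
      ContinuousAt.div (by fun_prop) (by fun_prop) (by norm_num)
    fun_prop
  have hf0 : f 0 = 1 := by simp [hf]
  have e1 : ∀ᶠ x in 𝓝 (0 : ℝ), 0 < f x := continuousAt_const.eventually_lt hfc (by simp [hf0])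
  have e2 : ∀ᶠ x in 𝓝 (0 : ℝ), a * Real.sqrt (1 + x) < Real.sqrt v * f x :=
    ContinuousAt.eventually_lt (by fun_prop) (by fun_prop) (by simpa [hf0] using ha)
  obtain ⟨ε, hε, h⟩ := Metric.eventually_nhds_iff.1 (e1.and e2)
  set δ := min (ε / 2) (1 / 4) with hδ
  have hδ0 : 0 < δ := by positivity
  have hδ4 : δ ≤ 1 / 4 := min_le_right _ _
  have hδε : δ < ε := (min_le_left _ _).trans_lt (by linarith)
  obtain ⟨h1, h2⟩ := h (y := δ) (by simpa [abs_of_pos hδ0] using hδε)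
  obtain ⟨K, hK⟩ := exists_nat_ge (1 / δ)
  have hK4 : (4 : ℝ) ≤ K := by
    refine le_trans ?_ hK
    rw [le_div_iff₀ hδ0]
    linarith
  have hK0 : (0 : ℝ) < K := by linarith
  have hKδ : 1 / (K : ℝ) ≤ δ := by
    rw [div_le_iff₀ hδ0] at hK
    rw [div_le_iff₀ hK0]
    linarith
  have hle : f δ ≤ (1 - δ) * Real.sqrt ((1 - 1 / K) / (1 + 3 * δ)) - 2 / Real.sqrt K := by
    have a1 : Real.sqrt ((1 - δ) / (1 + 3 * δ)) ≤ Real.sqrt ((1 - 1 / K) / (1 + 3 * δ)) := by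
      apply Real.sqrt_le_sqrt
      gcongr
    have a2 : 1 / Real.sqrt K ≤ Real.sqrt δ := by
      have := Real.sqrt_le_sqrt hKδ
      rwa [Real.sqrt_div zero_le_one, Real.sqrt_one] at this
    have a3 := mul_le_mul_of_nonneg_left a1 (by linarith : (0 : ℝ) ≤ 1 - δ)
    have a4 : 2 / Real.sqrt (K : ℝ) = 2 * (1 / Real.sqrt K) := by ring
    simp only [hf]
    rw [a4]
    linarith
  refine ⟨δ, K, hδ0, by linarith, by exact_mod_cast (by linarith : (2 : ℝ) ≤ K), by linarith, ?_⟩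
  exact h2.le.trans (mul_le_mul_of_nonneg_left hle (Real.sqrt_nonneg _))

lemma tendsto_log_add_one_atTop : Tendsto (fun k : ℕ => Real.log ((k : ℝ) + 1)) atTop atTop :=
  Real.tendsto_log_atTop.comp (tendsto_natCast_atTop_atTop.atTop_add tendsto_const_nhds)

lemma tendsto_log_add_one_div_pow {K : ℕ} (hK : 2 ≤ K) :
    Tendsto (fun k : ℕ => Real.log ((k : ℝ) + 1) / (K : ℝ) ^ k) atTop (𝓝 0) := by
  have hK1 : (1 : ℝ) < K := by exact_mod_cast hK
  refine squeeze_zero (fun k => by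
    have : 0 ≤ Real.log ((k : ℝ) + 1) := Real.log_nonneg (by linarith [k.cast_nonneg (α := ℝ)])
    positivity) (fun k => ?_) (tendsto_pow_const_div_const_pow_of_one_lt 1 hK1)
  rw [pow_one]
  gcongr
  have := Real.log_le_sub_one_of_pos (by positivity : (0 : ℝ) < (k : ℝ) + 1)
  linarith

/-- Lower half of the law of the iterated logarithm, with block sums. -/
lemma ae_frequently_le_sum_Ico (h0 : 0 < p) (h1 : p < 1) (hG : ∀ i, MeasurableSet (G i))
    (hind : iIndepSet G P) (hPG : ∀ i, P (G i) = ENNReal.ofReal p) {δ : ℝ} (hδ : 0 < δ)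
    (hδ' : δ < 1 / 2) {K : ℕ} (hK : 2 ≤ K) :
    ∀ᵐ ω ∂P, ∃ᶠ k : ℕ in atTop,
      (1 - δ) * Real.sqrt (2 * ((K : ℝ) ^ (k + 1) - K ^ k) * ((1 - p) / p) *
        (Real.log (k + 1) / (1 + 3 * δ)))
      ≤ ∑ i ∈ Finset.Ico (K ^ k) (K ^ (k + 1)), attemptStep p (G i) ω := by
  have hv : 0 < (1 - p) / p := div_pos (by linarith) h0
  set v := (1 - p) / p with hvdef
  have hK1 : (1 : ℝ) < K := by exact_mod_cast hK
  obtain ⟨s₀, hs₀, R, hT⟩ := exists_le_measureReal_ge (Ω := Ω) h0 h1 hδ hδ'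
  have hmon : Monotone fun k => K ^ k := fun a b hab => Nat.pow_le_pow_right (by omega) hab
  have hE := iIndepSet_le_sum_Ico (fun i => measurable_attemptStep (p := p) (hG i))
    (iIndepFun_attemptStep hind) hmon fun k => (1 - δ) *
      Real.sqrt (2 * ((K : ℝ) ^ (k + 1) - K ^ k) * v * (Real.log (k + 1) / (1 + 3 * δ)))
  set E : ℕ → Set Ω := fun k => {ω | (1 - δ) *
      Real.sqrt (2 * ((K : ℝ) ^ (k + 1) - K ^ k) * v * (Real.log (k + 1) / (1 + 3 * δ)))
      ≤ ∑ i ∈ Finset.Ico (K ^ k) (K ^ (k + 1)), attemptStep p (G i) ω} with hEdef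
  have hEm : ∀ k, MeasurableSet (E k) := fun k =>
    measurableSet_le measurable_const
      (Finset.measurable_sum _ fun i _ => measurable_attemptStep (hG i))
  have hev : ∀ᶠ k : ℕ in atTop, 1 / 2 * (1 / ((k : ℝ) + 1)) ≤ P.real (E k) := by
    -- This tilt `s` solves `(1 + 3 δ) m s² v / 2 = log (k + 1)` for block length `m = K ^ k (K -
    -- 1)`, so the tail bound is the divergent `1 / (2 (k + 1))`.
    have t0 : Tendsto (fun k : ℕ => Real.sqrt (2 / ((1 + 3 * δ) * v * (K - 1)) *
        (Real.log ((k : ℝ) + 1) / (K : ℝ) ^ k))) atTop (𝓝 0) := by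
      have := ((tendsto_log_add_one_div_pow hK).const_mul (2 / ((1 + 3 * δ) * v * (K - 1)))).sqrt
      simpa using this
    have t1 := tendsto_log_add_one_atTop.const_mul_atTop
      (by positivity : 0 < 2 / ((1 + 3 * δ) * v))
    filter_upwards [t0.eventually_lt_const hs₀, t1.eventually_ge_atTop R, eventually_ge_atTop 1]
      with k hk1 hk2 hk3
    have hkr : (1 : ℝ) ≤ k := by exact_mod_cast hk3
    have hl : 0 < Real.log ((k : ℝ) + 1) := Real.log_pos (by linarith)
    have hKk : (0 : ℝ) < (K : ℝ) ^ k := by positivity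
    have hKm : (0 : ℝ) < (K : ℝ) - 1 := by linarith
    set s := Real.sqrt (2 / ((1 + 3 * δ) * v * (K - 1)) *
        (Real.log ((k : ℝ) + 1) / (K : ℝ) ^ k)) with hs
    have hs2 : s ^ 2 = 2 / ((1 + 3 * δ) * v * (K - 1)) * (Real.log ((k : ℝ) + 1) / (K : ℝ) ^ k) :=
      Real.sq_sqrt (by positivity)
    have hs0 : 0 < s := Real.sqrt_pos.2 (by positivity)
    have hcard : ((Finset.Ico (K ^ k) (K ^ (k + 1))).card : ℝ) = (K : ℝ) ^ k * (K - 1) := by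
      rw [Nat.card_Ico, Nat.cast_sub (hmon (Nat.le_add_right k 1))]
      push_cast
      ring
    have hms : (K : ℝ) ^ k * (K - 1) * s ^ 2 = 2 / ((1 + 3 * δ) * v) * Real.log ((k : ℝ) + 1) := by
      rw [hs2]
      field_simp
    have := hT (Finset.Ico (K ^ k) (K ^ (k + 1))).card s hs0 hk1 (by rwa [hcard, hms]) P
      (fun ω => ∑ i ∈ Finset.Ico (K ^ k) (K ^ (k + 1)), attemptStep p (G i) ω)
      (Finset.measurable_sum _ fun i _ => measurable_attemptStep (hG i))
      (integrable_exp_mul_sum_attemptStep hG hind _) (mgf_sum_attemptStep h0.le hG hind hPG _)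
    rw [← hvdef, hcard, hms] at this
    have e1 : (1 + 3 * δ) * (2 / ((1 + 3 * δ) * v) * Real.log ((k : ℝ) + 1) * v / 2)
        = Real.log ((k : ℝ) + 1) := by field_simp
    have e2 : s * ((K : ℝ) ^ k * (K - 1)) * v
        = Real.sqrt (2 * ((K : ℝ) ^ (k + 1) - K ^ k) * v * (Real.log (k + 1) / (1 + 3 * δ))) := by
      symm
      rw [Real.sqrt_eq_iff_mul_self_eq (by
        have : (0 : ℝ) ≤ (K : ℝ) ^ (k + 1) - K ^ k := by
          rw [pow_succ]; nlinarith
        positivity) (by positivity)]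
      have : s * ((K : ℝ) ^ k * (K - 1)) * v * (s * ((K : ℝ) ^ k * (K - 1)) * v)
        = ((K : ℝ) ^ k * (K - 1) * s ^ 2) * ((K : ℝ) ^ k * (K - 1)) * v ^ 2 := by ring
      rw [this, hms]
      field_simp
      ring
    rw [e1, e2, Real.exp_neg, Real.exp_log (by positivity), inv_eq_one_div] at this
    exact this
  have hone := measure_limsup_eq_one hEm hE (tsum_measure_eq_top (by norm_num) hev)
  have hae : ∀ᵐ ω ∂P, ω ∈ limsup E atTop :=
    (prob_compl_eq_zero_iff (MeasurableSet.measurableSet_limsup hEm)).2 hone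
  filter_upwards [hae] with ω hω
  exact mem_limsup_iff_frequently_mem.1 hω

/-- A lower bound for the partial sums along a geometric sequence. -/
lemma ae_eventually_neg_le_sum_range (h0 : 0 < p) (h1 : p < 1) (hG : ∀ i, MeasurableSet (G i))
    (hind : iIndepSet G P) (hPG : ∀ i, P (G i) = ENNReal.ofReal p) {K : ℕ} (hK : 2 ≤ K) :
    ∀ᵐ ω ∂P, ∀ᶠ k : ℕ in atTop,
      -(2 * Real.sqrt (2 * (K : ℝ) ^ k * ((1 - p) / p) * Real.log (k + 1)))
      ≤ ∑ i ∈ Finset.range (K ^ k), attemptStep p (G i) ω := by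
  have hv : 0 < (1 - p) / p := div_pos (by linarith) h0
  set v := (1 - p) / p with hvdef
  have hK1 : (1 : ℝ) < K := by exact_mod_cast hK
  obtain ⟨s₀, hs₀, hT⟩ := exists_measureReal_le_neg_le (Ω := Ω) h0 h1
  have hb : Summable fun k : ℕ => 1 / ((k : ℝ) + 1) ^ 2 := by
    have := (summable_nat_add_iff 1).2 (Real.summable_one_div_nat_pow.2 (by norm_num : 1 < 2))
    simpa using this
  have hne := tsum_measure_ne_top (P := P) (E := fun k : ℕ => {ω | ∑ i ∈ Finset.range (K ^ k),
    attemptStep p (G i) ω ≤ -(2 * Real.sqrt (2 * (K : ℝ) ^ k * v * Real.log (k + 1)))}) hb (by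
    -- Here `s` solves `K ^ k s² v = 2 log (k + 1)`, so the tail is at most `(k + 1) ^ (-2)`.
    have t0 : Tendsto (fun k : ℕ => Real.sqrt (2 / v *
        (Real.log ((k : ℝ) + 1) / (K : ℝ) ^ k))) atTop (𝓝 0) := by
      have := ((tendsto_log_add_one_div_pow hK).const_mul (2 / v)).sqrt
      simpa using this
    filter_upwards [t0.eventually_lt_const hs₀, eventually_ge_atTop 1] with k hk1 hk3
    have hkr : (1 : ℝ) ≤ k := by exact_mod_cast hk3
    have hl : 0 < Real.log ((k : ℝ) + 1) := Real.log_pos (by linarith)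
    have hKk : (0 : ℝ) < (K : ℝ) ^ k := by positivity
    set s := Real.sqrt (2 / v * (Real.log ((k : ℝ) + 1) / (K : ℝ) ^ k)) with hs
    have hs2 : s ^ 2 = 2 / v * (Real.log ((k : ℝ) + 1) / (K : ℝ) ^ k) :=
      Real.sq_sqrt (by positivity)
    have hs0 : 0 < s := Real.sqrt_pos.2 (by positivity)
    have hcard : ((Finset.range (K ^ k)).card : ℝ) = (K : ℝ) ^ k := by simp
    have := hT (Finset.range (K ^ k)).card s hs0 hk1 P
      (fun ω => ∑ i ∈ Finset.range (K ^ k), attemptStep p (G i) ω)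
      (integrable_exp_mul_sum_attemptStep hG hind _) (mgf_sum_attemptStep h0.le hG hind hPG _)
    rw [← hvdef, hcard] at this
    have e1 : (K : ℝ) ^ k * s ^ 2 * v = 2 * Real.log ((k : ℝ) + 1) := by
      rw [hs2]
      field_simp
    have e2 : s * (K : ℝ) ^ k * v = Real.sqrt (2 * (K : ℝ) ^ k * v * Real.log (k + 1)) := by
      symm
      rw [Real.sqrt_eq_iff_mul_self_eq (by positivity) (by positivity)]
      have : s * (K : ℝ) ^ k * v * (s * (K : ℝ) ^ k * v)
        = ((K : ℝ) ^ k * s ^ 2 * v) * (K : ℝ) ^ k * v := by ring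
      rw [this, e1]
      ring
    rw [e1, e2, Real.exp_neg, two_mul (Real.log _), Real.exp_add,
      Real.exp_log (by positivity), ← sq, inv_eq_one_div] at this
    exact this)
  filter_upwards [ae_eventually_notMem hne] with ω hω
  filter_upwards [hω] with k hk
  exact (not_le.1 hk).le

/-- Lower half of the law of the iterated logarithm for centred Bernoulli variables. -/
theorem ae_frequently_mul_lilScale_le (h0 : 0 < p) (h1 : p < 1) (hG : ∀ i, MeasurableSet (G i))
    (hind : iIndepSet G P) (hPG : ∀ i, P (G i) = ENNReal.ofReal p) {a : ℝ}
    (ha : a < Real.sqrt ((1 - p) / p)) :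
    ∀ᵐ ω ∂P, ∃ᶠ n : ℕ in atTop, a * lilScale n ≤ ∑ i ∈ Finset.range n, attemptStep p (G i) ω := by
  have hv : 0 < (1 - p) / p := div_pos (by linarith) h0
  obtain ⟨δ, K, hδ, hδ', hK, hκ, haκ⟩ := exists_block_constants ha
  filter_upwards [ae_frequently_le_sum_Ico h0 h1 hG hind hPG hδ hδ' hK,
    ae_eventually_neg_le_sum_range h0 h1 hG hind hPG hK] with ω hω1 hω2
  set v := (1 - p) / p with hvdef
  have hK1 : (1 : ℝ) < K := by exact_mod_cast hK
  have hlogK : 0 < Real.log K := Real.log_pos hK1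
  have tK : Tendsto (fun k : ℕ => K ^ (k + 1)) atTop atTop :=
    (tendsto_pow_atTop_atTop_of_one_lt (by omega : 1 < K)).comp (tendsto_add_atTop_nat 1)
  refine tK.frequently ?_
  -- As `log log (K ^ (k + 1)) = log (k + 1) + log log K`, the constant is absorbed by the factor `1
  -- + δ`.
  have e3 := (tendsto_log_add_one_atTop.const_mul_atTop hδ).eventually_ge_atTop
    (Real.log (Real.log K))
  refine (hω1.and_eventually (hω2.and (e3.and (eventually_ge_atTop 1)))).mono ?_
  rintro k ⟨h1, h2, h3, h4⟩
  have hkr : (1 : ℝ) ≤ k := by exact_mod_cast h4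
  have hl : 0 < Real.log ((k : ℝ) + 1) := Real.log_pos (by linarith)
  set l := Real.log ((k : ℝ) + 1) with hldef
  set N : ℝ := (K : ℝ) ^ (k + 1) with hN
  have hN0 : 0 < N := by positivity
  have hNK : (K : ℝ) ^ k = N / K := by rw [hN, pow_succ]; field_simp
  set B := Real.sqrt (2 * N * l) with hB
  -- The last block is large infinitely often, and the earlier part can undo only a fraction of
  -- order `1 / √K` of it.
  have hsum : ∑ i ∈ Finset.range (K ^ (k + 1)), attemptStep p (G i) ω
      = ∑ i ∈ Finset.range (K ^ k), attemptStep p (G i) ω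
        + ∑ i ∈ Finset.Ico (K ^ k) (K ^ (k + 1)), attemptStep p (G i) ω :=
    (Finset.sum_range_add_sum_Ico _ (Nat.pow_le_pow_right (by omega) (Nat.le_succ k))).symm
  have b1 : Real.sqrt (2 * (N - K ^ k) * v * (l / (1 + 3 * δ)))
      = Real.sqrt v * B * Real.sqrt ((1 - 1 / K) / (1 + 3 * δ)) := by
    rw [hB, ← Real.sqrt_mul hv.le, ← Real.sqrt_mul (by positivity), hNK]
    congr 1
    field_simp
  have b2 : Real.sqrt (2 * (K : ℝ) ^ k * v * l) = Real.sqrt v * B * (1 / Real.sqrt K) := by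
    rw [hB, ← Real.sqrt_mul hv.le, mul_one_div, ← Real.sqrt_div (by positivity), hNK]
    congr 1
    field_simp
  have b3 : lilScale (K ^ (k + 1)) ≤ Real.sqrt (1 + δ) * B := by
    unfold lilScale
    rw [hB, ← Real.sqrt_mul (by positivity)]
    apply Real.sqrt_le_sqrt
    have : Real.log (Real.log ((K ^ (k + 1) : ℕ) : ℝ)) = l + Real.log (Real.log K) := by
      push_cast
      rw [Real.log_pow, Real.log_mul (by positivity) hlogK.ne']
      push_cast
      rfl
    rw [this]
    push_cast
    have : l + Real.log (Real.log K) ≤ (1 + δ) * l := by linarith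
    calc 2 * N * (l + Real.log (Real.log K)) ≤ 2 * N * ((1 + δ) * l) := by gcongr
      _ = _ := by ring
  rw [b1] at h1
  rw [b2] at h2
  rw [hsum]
  have hB0 : 0 ≤ B := Real.sqrt_nonneg _
  have hφ : 0 ≤ lilScale (K ^ (k + 1)) := Real.sqrt_nonneg _
  have h5 : Real.sqrt v * ((1 - δ) * Real.sqrt ((1 - 1 / K) / (1 + 3 * δ)) - 2 / Real.sqrt K) * B
      = (1 - δ) * (Real.sqrt v * B * Real.sqrt ((1 - 1 / K) / (1 + 3 * δ)))
        - 2 * (Real.sqrt v * B * (1 / Real.sqrt K)) := by ring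
  have h6 : a * lilScale (K ^ (k + 1)) ≤
      Real.sqrt v * ((1 - δ) * Real.sqrt ((1 - 1 / K) / (1 + 3 * δ)) - 2 / Real.sqrt K) * B := by
    rcases le_total 0 a with h | h
    · calc a * lilScale (K ^ (k + 1)) ≤ a * (Real.sqrt (1 + δ) * B) := by gcongr
        _ = a * Real.sqrt (1 + δ) * B := by ring
        _ ≤ _ := by gcongr
    · exact (mul_nonpos_of_nonpos_of_nonneg h hφ).trans
        (mul_nonneg (mul_nonneg (Real.sqrt_nonneg _) hκ) hB0)
  linarith

end Bernoulli

/-! ### Conditional moments and the exponential martingale -/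

namespace ScheduledSystem

variable {Ω : Type*} [mΩ : MeasurableSpace Ω] {P : Measure Ω} {p : Fin 2 → ℝ}

/-- The number of attempts of client `j` in the slots `1, …, t`. -/
def attempts (S : ScheduledSystem P p) (j : Fin 2) (t : ℕ) (ω : Ω) : ℕ :=
  ∑ l ∈ Finset.range t, if S.serve (l + 1) ω = some j then 1 else 0

variable (S : ScheduledSystem P p) (j : Fin 2)

lemma attempts_succ (t : ℕ) (ω : Ω) : S.attempts j (t + 1) ω
    = S.attempts j t ω + if S.serve (t + 1) ω = some j then 1 else 0 :=
  Finset.sum_range_succ _ _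

lemma attempts_mono (ω : Ω) : Monotone fun t => S.attempts j t ω :=
  monotone_nat_of_le_succ fun t => by rw [attempts_succ]; exact Nat.le_add_right _ _

lemma attempts_le (t : ℕ) (ω : Ω) : S.attempts j t ω ≤ t := by
  induction t with
  | zero => simp [attempts]
  | succ t ih => rw [attempts_succ]; split_ifs <;> omega

lemma u_eq_ite (t : ℕ) (ω : Ω) : S.u j t ω = if S.serve t ω = some j then 1 else 0 := by
  simp [u, Set.indicator_apply]

lemma sum_u_eq_attempts (t : ℕ) (ω : Ω) :
    ∑ l ∈ Finset.Icc 1 t, S.u j l ω = (S.attempts j t ω : ℝ) := by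
  induction t with
  | zero => simp [attempts]
  | succ t ih =>
    rw [Finset.sum_Icc_succ_top (by omega), ih, attempts_succ, u_eq_ite]
    split_ifs <;> simp

lemma M_succ (t : ℕ) (ω : Ω) : S.M j (t + 1) ω = S.M j t ω + S.m j (t + 1) ω :=
  Finset.sum_Icc_succ_top (by omega) _

lemma M_zero (ω : Ω) : S.M j 0 ω = 0 := by simp [M]

lemma g_eq_mul (t : ℕ) (ω : Ω) : S.g j t ω = S.u j t ω * (S.good t j).indicator 1 ω := by
  by_cases h : S.serve t ω = some j <;> by_cases h' : ω ∈ S.good t j <;>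
    simp [g, u, h, h']

lemma stronglyMeasurable_u (t : ℕ) : StronglyMeasurable[S.ℱ t] (S.u j (t + 1)) :=
  stronglyMeasurable_one.indicator (S.serve_predictable t j)

lemma stronglyMeasurable_g (t : ℕ) : StronglyMeasurable[S.ℱ (t + 1)] (S.g j (t + 1)) :=
  stronglyMeasurable_one.indicator (S.delivery_observed t j)

lemma stronglyMeasurable_m (t : ℕ) : StronglyMeasurable[S.ℱ (t + 1)] (S.m j (t + 1)) :=
  ((S.stronglyMeasurable_u j t).mono (S.ℱ.mono t.le_succ)).sub
    ((S.stronglyMeasurable_g j t).const_mul _)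

lemma stronglyMeasurable_M (t : ℕ) : StronglyMeasurable[S.ℱ t] (S.M j t) := by
  induction t with
  | zero =>
    rw [show S.M j 0 = fun _ => 0 from funext fun ω => S.M_zero j ω]
    exact stronglyMeasurable_const
  | succ t ih =>
    rw [show S.M j (t + 1) = fun ω => S.M j t ω + S.m j (t + 1) ω from
      funext fun ω => S.M_succ j t ω]
    exact (ih.mono (S.ℱ.mono t.le_succ)).add (S.stronglyMeasurable_m j t)

/-- Predictability of the clock; at `t = 0` the truncated `t - 1` is harmless because the sum is
empty. -/
lemma measurable_attempts (t : ℕ) : Measurable[S.ℱ (t - 1)] (S.attempts j t) := by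
  refine Finset.measurable_sum _ fun l hl => ?_
  have hl' : l ≤ t - 1 := by have := Finset.mem_range.1 hl; omega
  exact Measurable.ite (S.ℱ.mono hl' _ (S.serve_predictable l j)) measurable_const measurable_const

variable [IsProbabilityMeasure P]

lemma integrable_u (t : ℕ) : Integrable (S.u j (t + 1)) P :=
  (integrable_const (1 : ℝ)).indicator (S.ℱ.le t _ (S.serve_predictable t j))

lemma integrable_g (t : ℕ) : Integrable (S.g j (t + 1)) P :=
  (integrable_const (1 : ℝ)).indicator (S.ℱ.le (t + 1) _ (S.delivery_observed t j))

omit [IsProbabilityMeasure P] in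
lemma norm_g_le (t : ℕ) (ω : Ω) : ‖S.g j t ω‖ ≤ 1 := by
  unfold g
  by_cases h : ω ∈ {ω | S.serve t ω = some j} ∩ S.good t j
  · rw [Set.indicator_of_mem h]; simp
  · rw [Set.indicator_of_notMem h]; simp

lemma integrable_mul_g {b : Ω → ℝ} (hb : Integrable b P) (t : ℕ) :
    Integrable (fun ω => b ω * S.g j (t + 1) ω) P :=
  hb.mul_bdd (c := 1) (S.integrable_g j t).aestronglyMeasurable
    (Eventually.of_forall fun ω => S.norm_g_le j _ ω)

lemma integrable_mul_u {b : Ω → ℝ} (hb : Integrable b P) (t : ℕ) :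
    Integrable (fun ω => b ω * S.u j (t + 1) ω) P := by
  refine hb.mul_bdd (c := 1) (S.integrable_u j t).aestronglyMeasurable
    (Eventually.of_forall fun ω => ?_)
  rw [u_eq_ite]
  split_ifs <;> simp

/-- Being attempted is a past event, so on any past event the independent channel contributes just a
factor `p j`. -/
lemma condExp_g (hp : 0 ≤ p j) (t : ℕ) :
    P[S.g j (t + 1) | S.ℱ t] =ᵐ[P] fun ω => p j * S.u j (t + 1) ω := by
  symm
  refine ae_eq_condExp_of_forall_setIntegral_eq (S.ℱ.le t) (S.integrable_g j t)
    (fun s _ _ => ((S.integrable_u j t).const_mul _).integrableOn) (fun s hs _ => ?_)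
    ((S.stronglyMeasurable_u j t).const_mul _).aestronglyMeasurable
  have hA := S.ℱ.le t _ (S.serve_predictable t j)
  have hB := S.ℱ.le (t + 1) _ (S.delivery_observed t j)
  rw [integral_const_mul]
  unfold u g
  rw [integral_indicator_one hA, integral_indicator_one hB, measureReal_restrict_apply hA,
    measureReal_restrict_apply hB]
  have hi := S.good_indep t j _ ((S.serve_predictable t j).inter hs)
  have := hi.measure_inter_eq_mul
  rw [S.good_prob] at this
  simp only [measureReal_def]
  rw [Set.inter_comm _ (S.good (t + 1) j), Set.inter_assoc, this, ENNReal.toReal_mul,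
    ENNReal.toReal_ofReal hp]

/-- Conditional expectation of a variable that is affine in the delivery indicator. -/
lemma condExp_add_mul_g (hp : 0 ≤ p j) (t : ℕ) {a b : Ω → ℝ} (ha : StronglyMeasurable[S.ℱ t] a)
    (hb : StronglyMeasurable[S.ℱ t] b) (hai : Integrable a P) (hbi : Integrable b P) :
    P[fun ω => a ω + b ω * S.g j (t + 1) ω | S.ℱ t]
      =ᵐ[P] fun ω => a ω + b ω * (p j * S.u j (t + 1) ω) := by
  have h1 := condExp_add hai (S.integrable_mul_g j hbi t) (S.ℱ t)
  have h2 := condExp_mul_of_stronglyMeasurable_left hb (S.integrable_mul_g j hbi t)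
    (S.integrable_g j t)
  have h3 := condExp_of_stronglyMeasurable (S.ℱ.le t) ha hai
  filter_upwards [h1, h2, S.condExp_g j hp t] with ω e1 e2 e3
  rw [show (fun ω => a ω + b ω * S.g j (t + 1) ω) = a + fun ω => b ω * S.g j (t + 1) ω from rfl,
    e1, Pi.add_apply, h3,
    show (fun ω => b ω * S.g j (t + 1) ω) = b * S.g j (t + 1) from rfl, e2, Pi.mul_apply, e3]

lemma integrable_m (t : ℕ) : Integrable (S.m j (t + 1)) P :=
  (S.integrable_u j t).sub ((S.integrable_g j t).const_mul _)

lemma integrable_M (t : ℕ) : Integrable (S.M j t) P := by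
  induction t with
  | zero =>
    rw [show S.M j 0 = fun _ => 0 from funext fun ω => S.M_zero j ω]
    exact integrable_const _
  | succ t ih =>
    rw [show S.M j (t + 1) = fun ω => S.M j t ω + S.m j (t + 1) ω from
      funext fun ω => S.M_succ j t ω]
    exact ih.add (S.integrable_m j t)

theorem martingale_M (hp : 0 < p j) : Martingale (S.M j) S.ℱ P := by
  refine martingale_nat (fun t => S.stronglyMeasurable_M j t) (S.integrable_M j) fun t => ?_
  have e : S.M j (t + 1)
      = fun ω => (S.M j t ω + S.u j (t + 1) ω) + -(1 / p j) * S.g j (t + 1) ω := by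
    ext ω
    rw [M_succ, m]
    ring
  have h := S.condExp_add_mul_g j hp.le t
    ((S.stronglyMeasurable_M j t).add (S.stronglyMeasurable_u j t))
    (stronglyMeasurable_const (b := -(1 / p j)))
    ((S.integrable_M j t).add (S.integrable_u j t)) (integrable_const _)
  rw [e]
  filter_upwards [h] with ω hω
  refine Eq.trans ?_ hω.symm
  simp only [Pi.add_apply]
  field_simp
  ring

/-- For indicators with `u g = g`, the square is affine in `g`: `m² = u + (1 / p² - 2 / p) g`.
Replacing `g` by `p u` leaves `u (1 / p - 1)`. -/
theorem condExp_sq_m (hp : 0 < p j) {t : ℕ} (ht : 1 ≤ t) :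
    P[fun ω => S.m j t ω ^ 2 | S.ℱ (t - 1)]
      =ᵐ[P] fun ω => S.u j t ω * ((1 - p j) / p j) := by
  obtain ⟨t, rfl⟩ := Nat.exists_eq_add_of_le' ht
  rw [Nat.add_sub_cancel]
  have e : (fun ω => S.m j (t + 1) ω ^ 2)
      = fun ω => S.u j (t + 1) ω + ((1 / p j) ^ 2 - 2 / p j) * S.g j (t + 1) ω := by
    ext ω
    rw [m, g_eq_mul, u_eq_ite]
    by_cases h : S.serve (t + 1) ω = some j <;> by_cases h' : ω ∈ S.good (t + 1) j <;>
      simp [h, h']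
    ring
  have h := S.condExp_add_mul_g j hp.le t (S.stronglyMeasurable_u j t)
    (stronglyMeasurable_const (b := (1 / p j) ^ 2 - 2 / p j)) (S.integrable_u j t)
    (integrable_const _)
  rw [e]
  filter_upwards [h] with ω hω
  rw [hω]
  field_simp
  ring

/-- The exponential martingale of `M_j`. -/
noncomputable def expMartingale (r : ℝ) (t : ℕ) (ω : Ω) : ℝ :=
  Real.exp (r * S.M j t ω) / attemptMGF (p j) r ^ S.attempts j t ω

-- The successor is written in a form affine in `g`, as `condExp_add_mul_g` requires.
omit [IsProbabilityMeasure P] in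
lemma expMartingale_succ (hp : 0 < p j) (hp1 : p j ≤ 1) (r : ℝ) (t : ℕ) (ω : Ω) :
    S.expMartingale j r (t + 1) ω
      = (S.expMartingale j r t ω
          + S.expMartingale j r t ω * S.u j (t + 1) ω * (Real.exp r / attemptMGF (p j) r - 1))
        + S.expMartingale j r t ω
            * ((Real.exp (r * (1 - 1 / p j)) - Real.exp r) / attemptMGF (p j) r)
          * S.g j (t + 1) ω := by
  have hL := (attemptMGF_pos hp hp1 r).ne'
  unfold expMartingale
  rw [M_succ, m, g_eq_mul, u_eq_ite, attempts_succ, mul_add, Real.exp_add]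
  by_cases h : S.serve (t + 1) ω = some j
  · by_cases h' : ω ∈ S.good (t + 1) j
    · simp only [h, h', if_true, Set.indicator_of_mem, Pi.one_apply, mul_one, pow_succ]
      field_simp
      ring
    · simp only [h, h', if_true, Set.indicator_of_notMem, not_false_eq_true, mul_one, mul_zero,
        sub_zero, add_zero, pow_succ]
      field_simp
      ring
  · simp [h]

omit [IsProbabilityMeasure P] in
lemma stronglyMeasurable_expMartingale (r : ℝ) (t : ℕ) :
    StronglyMeasurable[S.ℱ t] (S.expMartingale j r t) := by
  have h1 : Measurable[S.ℱ t] (S.M j t) := (S.stronglyMeasurable_M j t).measurable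
  have h2 : Measurable[S.ℱ t] (S.attempts j t) :=
    (S.measurable_attempts j t).mono (S.ℱ.mono (Nat.sub_le t 1)) le_rfl
  refine Measurable.stronglyMeasurable ?_
  unfold expMartingale
  exact (Real.measurable_exp.comp (h1.const_mul r)).div (h2.const_pow _)

lemma integrable_expMartingale (hp : 0 < p j) (hp1 : p j ≤ 1) (r : ℝ) (t : ℕ) :
    Integrable (S.expMartingale j r t) P := by
  induction t with
  | zero =>
    rw [show S.expMartingale j r 0 = fun _ => 1 from funext fun ω => by
      simp [expMartingale, M_zero, attempts]]
    exact integrable_const _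
  | succ t ih =>
    rw [funext (S.expMartingale_succ j hp hp1 r t)]
    exact (ih.add ((S.integrable_mul_u j ih t).mul_const _)).add
      (S.integrable_mul_g j (ih.mul_const _) t)

/-- After `g` is replaced by `p u`, the coefficient of `u` vanishes precisely by the definition of
`attemptMGF`. -/
theorem martingale_expMartingale (hp : 0 < p j) (hp1 : p j ≤ 1) (r : ℝ) :
    Martingale (S.expMartingale j r) S.ℱ P := by
  refine martingale_nat (S.stronglyMeasurable_expMartingale j r)
    (S.integrable_expMartingale j hp hp1 r) fun t => ?_
  have hm := S.stronglyMeasurable_expMartingale j r t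
  have hi := S.integrable_expMartingale j hp hp1 r t
  have h := S.condExp_add_mul_g j hp.le t
    (hm.add ((hm.mul (S.stronglyMeasurable_u j t)).mul_const
      (Real.exp r / attemptMGF (p j) r - 1)))
    (hm.mul_const ((Real.exp (r * (1 - 1 / p j)) - Real.exp r) / attemptMGF (p j) r))
    (hi.add ((S.integrable_mul_u j hi t).mul_const _)) (hi.mul_const _)
  rw [funext (S.expMartingale_succ j hp hp1 r t)]
  filter_upwards [h] with ω hω
  refine Eq.trans ?_ hω.symm
  have hL := (attemptMGF_pos hp hp1 r).ne'
  have e : Real.exp r / attemptMGF (p j) r - 1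
      = -((Real.exp (r * (1 - 1 / p j)) - Real.exp r) / attemptMGF (p j) r * p j) := by
    have hdef : attemptMGF (p j) r
      = p j * Real.exp (r * (1 - 1 / p j)) + (1 - p j) * Real.exp r := rfl
    generalize Real.exp (r * (1 - 1 / p j)) = A at hdef ⊢
    field_simp
    rw [hdef]
    ring
  simp only [Pi.add_apply, Pi.mul_apply]
  rw [e]
  ring

/-- Ville's inequality for the exponential martingale. -/
lemma measureReal_exists_exp_le_le (hp : 0 < p j) (hp1 : p j ≤ 1) (r x : ℝ) (n : ℕ) :
    P.real {ω | ∃ k ≤ n, Real.exp x ≤ S.expMartingale j r k ω} ≤ Real.exp (-x) := by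
  have hmart := S.martingale_expMartingale j hp hp1 r
  have hnn : 0 ≤ S.expMartingale j r := fun t ω =>
    div_nonneg (Real.exp_pos _).le (pow_nonneg (attemptMGF_pos hp hp1 r).le _)
  have h := maximal_ineq hmart.submartingale hnn (ε := ⟨Real.exp x, (Real.exp_pos x).le⟩) n
  have hset : {ω | ∃ k ≤ n, Real.exp x ≤ S.expMartingale j r k ω}
      = {ω | Real.exp x ≤ (Finset.range (n + 1)).sup' Finset.nonempty_range_add_one
          fun k => S.expMartingale j r k ω} := by
    ext ω
    simp [Finset.le_sup'_iff]
  have hint : ∫ ω, S.expMartingale j r n ω ∂P = 1 := by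
    have := hmart.setIntegral_eq (Nat.zero_le n) (MeasurableSet.univ)
    simp only [Measure.restrict_univ] at this
    rw [← this]
    simp [expMartingale, M_zero, attempts]
  have hle : ∀ s : Set Ω, ENNReal.ofReal (∫ ω in s, S.expMartingale j r n ω ∂P) ≤ 1 := fun s => by
    rw [← ENNReal.ofReal_one, ← hint]
    exact ENNReal.ofReal_le_ofReal (setIntegral_le_integral
      (S.integrable_expMartingale j hp hp1 r n) (Eventually.of_forall (hnn n)))
  have h2 := h.trans (hle _)
  rw [hset]
  have h3 := ENNReal.toReal_mono ENNReal.one_ne_top h2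
  rw [ENNReal.toReal_mul] at h3
  simp only [ENNReal.toReal_one] at h3
  rw [Real.exp_neg, ← one_div, le_div_iff₀ (Real.exp_pos x), mul_comm]
  exact h3

end ScheduledSystem

/-! ### Upper half of the law of the iterated logarithm -/

lemma tendsto_log_add_one_div_pow_succ {θ : ℝ} (hθ : 1 < θ) :
    Tendsto (fun k : ℕ => Real.log ((k : ℝ) + 1) / θ ^ (k + 1)) atTop (𝓝 0) := by
  refine squeeze_zero (fun k => by
    have : 0 ≤ Real.log ((k : ℝ) + 1) := Real.log_nonneg (by linarith [k.cast_nonneg (α := ℝ)])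
    positivity) (fun k => ?_) ((tendsto_pow_const_div_const_pow_of_one_lt 1 hθ).comp
      (tendsto_add_atTop_nat 1))
  simp only [Function.comp_apply, pow_one]
  gcongr
  have := Real.log_le_sub_one_of_pos (by positivity : (0 : ℝ) < (k : ℝ) + 1)
  push_cast
  linarith

/-- Within a geometric block, `log (k + 1)` is controlled by `log log t`. -/
lemma eventually_log_add_one_le_mul_log_log {θ : ℝ} (hθ : 1 < θ) :
    ∀ᶠ k : ℕ in atTop, ∀ t : ℝ, θ ^ k ≤ t → Real.log (k + 1) ≤ θ * Real.log (Real.log t) := by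
  have hlθ : 0 < Real.log θ := Real.log_pos hθ
  have h1 : 0 < 1 - 1 / θ := by
    rw [sub_pos, div_lt_one (by linarith)]
    exact hθ
  filter_upwards [(tendsto_log_add_one_atTop.const_mul_atTop h1).eventually_ge_atTop
    (Real.log 2 - Real.log (Real.log θ)), eventually_ge_atTop 1] with k hk hk1 t ht
  have hkr : (1 : ℝ) ≤ k := by exact_mod_cast hk1
  have e1 : Real.log ((k : ℝ) + 1) ≤ Real.log 2 + Real.log k := by
    rw [← Real.log_mul (by norm_num) (by positivity)]
    exact Real.log_le_log (by positivity) (by linarith)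
  have e2 : (k : ℝ) * Real.log θ ≤ Real.log t := by
    rw [← Real.log_pow]
    exact Real.log_le_log (by positivity) ht
  have e3 : Real.log k + Real.log (Real.log θ) ≤ Real.log (Real.log t) := by
    rw [← Real.log_mul (by positivity) hlθ.ne']
    exact Real.log_le_log (by positivity) e2
  have e4 : 1 / θ * Real.log ((k : ℝ) + 1) ≤ Real.log (Real.log t) := by linarith
  rwa [one_div, inv_mul_le_iff₀ (by linarith)] at e4

namespace ScheduledSystem

variable {Ω : Type*} [mΩ : MeasurableSpace Ω] {P : Measure Ω} {p : Fin 2 → ℝ}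
  (S : ScheduledSystem P p) (j : Fin 2)

/-- Upper half of the law of the iterated logarithm, for `M_j` and `-M_j`. -/
theorem ae_eventually_mul_M_le [IsProbabilityMeasure P] (hp : 0 < p j) (hp1 : p j ≤ 1)
    {a w σ : ℝ} (ha : 0 < a) (hw : (1 - p j) / p j < w) (hσ : |σ| = 1) :
    ∀ᵐ ω ∂P, (∀ᶠ t : ℕ in atTop, (S.attempts j t ω : ℝ) ≤ a * t) →
      ∀ᶠ t : ℕ in atTop, σ * S.M j t ω ≤ Real.sqrt (a * w) * lilScale t := by
  have hv : 0 ≤ (1 - p j) / p j := div_nonneg (by linarith) hp.le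
  set v := (1 - p j) / p j with hvdef
  have hw0 : 0 < w := hv.trans_lt hw
  set w' := (v + w) / 2 with hw'
  have hw'0 : 0 < w' := by linarith
  have hw'w : w' < w := by linarith
  -- Three factors `θ` are lost: in the Ville level, in the block length, and in comparing `log (k +
  -- 1)` with `log log t`. Hence `θ ^ 3 w' = w`.
  set θ := (w / w') ^ (1 / 3 : ℝ) with hθdef
  have hθ : 1 < θ := Real.one_lt_rpow ((one_lt_div hw'0).2 hw'w) (by norm_num)
  have hθ3 : θ ^ 3 * w' = w := by
    rw [hθdef, ← Real.rpow_natCast, ← Real.rpow_mul (by positivity)]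
    norm_num
    field_simp
  have hθ0 : 0 < θ := by linarith
  obtain ⟨s₀, hs₀, hL⟩ := Metric.eventually_nhds_iff.1
    (eventually_attemptMGF_le hp hp1 (by linarith : 0 < w' - v))
  -- This tilt balances the two terms of the exponential bound: `a θ ^ (k + 1) s² w' / 2 = θ log (k
  -- + 1)`.
  set s : ℕ → ℝ := fun k =>
    Real.sqrt (2 * θ / (w' * a) * (Real.log ((k : ℝ) + 1) / θ ^ (k + 1))) with hs
  have hs0 : Tendsto s atTop (𝓝 0) := by
    have := ((tendsto_log_add_one_div_pow_succ hθ).const_mul (2 * θ / (w' * a))).sqrt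
    simpa using this
  have hb : Summable fun k : ℕ => ((k : ℝ) + 1) ^ (-θ) := by
    have := (summable_nat_add_iff 1).2 (Real.summable_nat_rpow.2 (by linarith : -θ < -1))
    simpa using this
  -- The level `θ log (k + 1)` yields probabilities at most `(k + 1) ^ (-θ)`, summable as `θ > 1`;
  -- the sign `σ` treats `M` and `-M` together.
  have hne := tsum_measure_ne_top (P := P) (E := fun k : ℕ => {ω | ∃ t ≤ ⌊θ ^ (k + 1)⌋₊,
      Real.exp (θ * Real.log ((k : ℝ) + 1)) ≤ S.expMartingale j (σ * s k) t ω}) hb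
    (Eventually.of_forall fun k => by
      refine (S.measureReal_exists_exp_le_le j hp hp1 _ _ _).trans (le_of_eq ?_)
      rw [Real.rpow_def_of_pos (by positivity)]
      congr 1
      ring)
  filter_upwards [ae_eventually_notMem hne] with ω hω hN
  obtain ⟨t₀, ht₀⟩ := eventually_atTop.1 hN
  obtain ⟨k₀, hk₀⟩ := eventually_atTop.1 (hω.and ((hs0.eventually_lt_const hs₀).and
    ((eventually_log_add_one_le_mul_log_log hθ).and (eventually_ge_atTop 1))))
  filter_upwards [eventually_ge_atTop t₀, eventually_ge_atTop 1,
    tendsto_natCast_atTop_atTop.eventually_ge_atTop (θ ^ k₀)] with t ht1 ht2 ht3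
  obtain ⟨k, hk1, hk2⟩ := exists_nat_pow_near (by exact_mod_cast ht2 : (1 : ℝ) ≤ t) hθ
  have hkk : k₀ ≤ k := by
    have := (pow_lt_pow_iff_right₀ hθ).1 (ht3.trans_lt hk2)
    omega
  obtain ⟨c1, c2, c3, c4⟩ := hk₀ k hkk
  have c3 := c3 t hk1
  have hkr : (1 : ℝ) ≤ k := by exact_mod_cast c4
  set l := Real.log ((k : ℝ) + 1) with hl
  have hl0 : 0 < l := Real.log_pos (by linarith)
  have hs2 : s k ^ 2 = 2 * θ / (w' * a) * (l / θ ^ (k + 1)) := Real.sq_sqrt (by positivity)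
  have hsk : 0 < s k := Real.sqrt_pos.2 (by positivity)
  have c1' : S.expMartingale j (σ * s k) t ω < Real.exp (θ * l) := by
    by_contra hcon
    exact c1 ⟨t, Nat.le_floor hk2.le, not_lt.1 hcon⟩
  have hLpos := attemptMGF_pos hp hp1 (σ * s k)
  have hLle : attemptMGF (p j) (σ * s k) ≤ Real.exp (s k ^ 2 * w' / 2) := by
    have h := hL (y := σ * s k) (by simpa [abs_mul, hσ, abs_of_pos hsk] using c2)
    rwa [mul_pow, ← sq_abs σ, hσ, one_pow, one_mul, ← hvdef, add_sub_cancel] at h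
  unfold expMartingale at c1'
  rw [div_lt_iff₀ (pow_pos hLpos _)] at c1'
  have h1 : Real.exp (σ * s k * S.M j t ω)
      < Real.exp (θ * l + S.attempts j t ω * (s k ^ 2 * w' / 2)) := by
    rw [Real.exp_add, Real.exp_nat_mul]
    exact c1'.trans_le (mul_le_mul_of_nonneg_left (pow_le_pow_left₀ hLpos.le hLle _)
      (Real.exp_pos _).le)
  have h2 := (Real.exp_lt_exp.1 h1).le
  have h3 : (S.attempts j t ω : ℝ) ≤ a * θ ^ (k + 1) :=
    (ht₀ t ht1).trans (mul_le_mul_of_nonneg_left hk2.le ha.le)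
  have h4 : a * θ ^ (k + 1) * (s k ^ 2 * w' / 2) = θ * l := by
    rw [hs2]
    field_simp
  have h5 : s k * (σ * S.M j t ω) ≤ s k * (s k * (w' * a * θ ^ (k + 1))) := by
    have := mul_le_mul_of_nonneg_right h3 (by positivity : 0 ≤ s k ^ 2 * w' / 2)
    nlinarith
  refine (le_of_mul_le_mul_left h5 hsk).trans ?_
  unfold lilScale
  rw [← Real.sqrt_mul (by positivity)]
  apply Real.le_sqrt_of_sq_le
  have ht0 : (0 : ℝ) < t := by exact_mod_cast ht2
  calc (s k * (w' * a * θ ^ (k + 1))) ^ 2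
      = s k ^ 2 * (w' * a * θ ^ (k + 1)) ^ 2 := by ring
    _ = 2 * θ * w' * a * l * (θ * θ ^ k) := by
      rw [hs2, ← pow_succ']
      field_simp
    _ ≤ 2 * θ * w' * a * (θ * Real.log (Real.log t)) * (θ * t) := by
      have hLL := mul_nonneg (by positivity : 0 ≤ 2 * θ * w' * a) (hl0.le.trans c3)
      gcongr
    _ = θ ^ 3 * w' * a * (2 * t * Real.log (Real.log t)) := by ring
    _ = a * w * (2 * t * Real.log (Real.log t)) := by rw [hθ3]; ring

end ScheduledSystem

/-! ### Asymptotics of `lilScale` -/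

lemma tendsto_log_log_natCast :
    Tendsto (fun t : ℕ => Real.log (Real.log (t : ℝ))) atTop atTop :=
  (Real.tendsto_log_atTop.comp Real.tendsto_log_atTop).comp tendsto_natCast_atTop_atTop

lemma eventually_lilScale_pos : ∀ᶠ t : ℕ in atTop, 0 < lilScale t := by
  filter_upwards [tendsto_log_log_natCast.eventually_gt_atTop 0, eventually_ge_atTop 1] with t h h1
  have : (0 : ℝ) < t := by exact_mod_cast h1
  exact Real.sqrt_pos.2 (by positivity)

lemma tendsto_lilScale_div : Tendsto (fun t : ℕ => lilScale t / t) atTop (𝓝 0) := by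
  have h : Tendsto (fun t : ℕ => Real.sqrt (2 * (Real.log t / t))) atTop (𝓝 0) := by
    have h0 : Tendsto (fun x : ℝ => Real.log x / x) atTop (𝓝 0) :=
      Real.isLittleO_log_id_atTop.tendsto_div_nhds_zero
    have := ((h0.comp tendsto_natCast_atTop_atTop).const_mul 2).sqrt
    simpa using this
  refine squeeze_zero' (Eventually.of_forall fun t =>
    div_nonneg (Real.sqrt_nonneg _) t.cast_nonneg) ?_ h
  filter_upwards [eventually_ge_atTop 3] with t ht
  have ht0 : (0 : ℝ) < t := by exact_mod_cast (by omega : 0 < t)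
  have hl : 0 < Real.log t := Real.log_pos (by exact_mod_cast (by omega : 1 < t))
  have hll : Real.log (Real.log t) ≤ Real.log t := by
    linarith [Real.log_le_sub_one_of_pos hl]
  unfold lilScale
  rw [div_le_iff₀ ht0]
  have e : Real.sqrt (2 * (Real.log t / t)) * t = Real.sqrt (2 * (Real.log t / t) * t ^ 2) := by
    rw [Real.sqrt_mul (x := 2 * (Real.log t / t)) (by positivity), Real.sqrt_sq ht0.le]
  rw [e]
  apply Real.sqrt_le_sqrt
  calc 2 * (t : ℝ) * Real.log (Real.log t) ≤ 2 * t * Real.log t := by gcongr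
    _ = 2 * (Real.log t / t) * t ^ 2 := by field_simp

/-- Comparison of `lilScale` at two proportional times. -/
lemma eventually_sqrt_mul_lilScale_le {r κ : ℝ} (hr : 0 < r) (hκ : 0 < κ) (hκ1 : κ < 1) :
    ∀ᶠ t : ℕ in atTop, ∀ n : ℕ, r * t ≤ n → Real.sqrt (κ * r) * lilScale t ≤ lilScale n := by
  -- For large `t`, `log n ≥ log t + log r ≥ (log t) / 2`, hence `log log n ≥ log log t - log 2 ≥ κ
  -- log log t`.
  have t1 : Tendsto (fun t : ℕ => 1 / 2 * Real.log (t : ℝ)) atTop atTop :=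
    (Real.tendsto_log_atTop.comp tendsto_natCast_atTop_atTop).const_mul_atTop (by norm_num)
  filter_upwards [t1.eventually_ge_atTop (-Real.log r), t1.eventually_gt_atTop 0,
    (tendsto_log_log_natCast.const_mul_atTop (sub_pos.2 hκ1)).eventually_ge_atTop (Real.log 2),
    eventually_ge_atTop 1, tendsto_log_log_natCast.eventually_gt_atTop 0]
    with t h1 h2 h3 h4 h5 n hn
  have ht0 : (0 : ℝ) < t := by exact_mod_cast h4
  have e1 : Real.log r + Real.log t ≤ Real.log n := by
    rw [← Real.log_mul hr.ne' ht0.ne']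
    exact Real.log_le_log (by positivity) hn
  have e2 : 1 / 2 * Real.log t ≤ Real.log n := by linarith
  have e3 : Real.log (Real.log t) - Real.log 2 ≤ Real.log (Real.log n) := by
    rw [← Real.log_div (by linarith) (by norm_num)]
    exact Real.log_le_log (by linarith) (by linarith)
  have e4 : κ * Real.log (Real.log t) ≤ Real.log (Real.log n) := by linarith
  unfold lilScale
  rw [← Real.sqrt_mul (by positivity)]
  apply Real.sqrt_le_sqrt
  calc κ * r * (2 * t * Real.log (Real.log t))
      = 2 * (r * t) * (κ * Real.log (Real.log t)) := by ring
    _ ≤ 2 * n * Real.log (Real.log n) := by gcongr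

/-! ### Time change to a random walk -/

namespace ScheduledSystem

variable {Ω : Type*} [mΩ : MeasurableSpace Ω] {P : Measure Ω} {p : Fin 2 → ℝ}
  (S : ScheduledSystem P p) (j : Fin 2)

/-- The event that the attempt number `k` (counted from zero) of client `j` is in slot `t + 1`. -/
def attemptAt (k t : ℕ) : Set Ω := {ω | S.serve (t + 1) ω = some j ∧ S.attempts j t ω = k}

/-- The event that the attempt number `k` of client `j` takes place and succeeds. -/
def attemptSucceeds (k : ℕ) : Set Ω := ⋃ t, S.attemptAt j k t ∩ S.good (t + 1) j

variable {S j}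

lemma lt_of_mem_attemptAt {i k l t : ℕ} {ω : Ω} (hik : i < k) (hl : ω ∈ S.attemptAt j i l)
    (ht : ω ∈ S.attemptAt j k t) : l < t := by
  by_contra h
  have := S.attempts_mono j ω (not_lt.1 h)
  simp only [hl.2, ht.2] at this
  omega

lemma eq_of_mem_attemptAt {k l t : ℕ} {ω : Ω} (hl : ω ∈ S.attemptAt j k l)
    (ht : ω ∈ S.attemptAt j k t) : l = t := by
  have key : ∀ l t, ω ∈ S.attemptAt j k l → ω ∈ S.attemptAt j k t → ¬ l < t := by
    intro l t hl ht h
    have := S.attempts_mono j ω (Nat.succ_le_of_lt h)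
    simp only [Nat.succ_eq_add_one, attempts_succ, hl.1, hl.2, ht.2, if_true] at this
    omega
  exact le_antisymm (not_lt.1 (key t l ht hl)) (not_lt.1 (key l t hl ht))

lemma exists_mem_attemptAt {ω : Ω} {k t : ℕ} (h : k < S.attempts j t ω) :
    ∃ l, ω ∈ S.attemptAt j k l := by
  induction t with
  | zero => simp [attempts] at h
  | succ t ih =>
    by_cases h' : k < S.attempts j t ω
    · exact ih h'
    · rw [attempts_succ] at h
      by_cases hs : S.serve (t + 1) ω = some j
      · rw [if_pos hs] at h
        exact ⟨t, hs, by omega⟩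
      · rw [if_neg hs] at h
        omega

/-- The counter moves by unit steps and so skips no value; walk lengths can thus be pulled back to
slots. -/
lemma exists_attempts_eq {ω : Ω} {n t : ℕ} (h : n ≤ S.attempts j t ω) :
    ∃ l, S.attempts j l ω = n := by
  cases n with
  | zero => exact ⟨0, by simp [attempts]⟩
  | succ n =>
    obtain ⟨l, hl, hl'⟩ := exists_mem_attemptAt (Nat.lt_of_succ_le h)
    exact ⟨l + 1, by rw [attempts_succ, if_pos hl, hl']⟩

variable (S j)

lemma measurableSet_attemptAt (k t : ℕ) : MeasurableSet[S.ℱ t] (S.attemptAt j k t) := by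
  have h := (S.measurable_attempts j t).mono (S.ℱ.mono (Nat.sub_le t 1)) le_rfl
  exact (S.serve_predictable t j).inter (h (measurableSet_singleton k))

/-- The channel event alone need not be observed; intersecting with the attempt turns it into a
delivery. -/
lemma measurableSet_attemptAt_inter_good (k t : ℕ) :
    MeasurableSet[S.ℱ (t + 1)] (S.attemptAt j k t ∩ S.good (t + 1) j) := by
  have : S.attemptAt j k t ∩ S.good (t + 1) j
      = S.attemptAt j k t ∩ ({ω | S.serve (t + 1) ω = some j} ∩ S.good (t + 1) j) := by
    ext ω
    simp only [attemptAt, Set.mem_inter_iff, Set.mem_ofPred_eq]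
    tauto
  rw [this]
  exact (S.ℱ.mono t.le_succ _ (S.measurableSet_attemptAt j k t)).inter (S.delivery_observed t j)

lemma measurableSet_attemptSucceeds (k : ℕ) : MeasurableSet (S.attemptSucceeds j k) :=
  MeasurableSet.iUnion fun t => S.ℱ.le (t + 1) _ (S.measurableSet_attemptAt_inter_good j k t)

/-- Outcomes of earlier attempts are known before a later attempt. -/
lemma measurableSet_attemptAt_inter {k t : ℕ} {s : Finset ℕ} (hs : ∀ i ∈ s, i < k) :
    MeasurableSet[S.ℱ t] (S.attemptAt j k t ∩ ⋂ i ∈ s, S.attemptSucceeds j i) := by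
  have : S.attemptAt j k t ∩ ⋂ i ∈ s, S.attemptSucceeds j i
      = S.attemptAt j k t ∩ ⋂ i ∈ s, ⋃ l ∈ Finset.range t,
        (S.attemptAt j i l ∩ S.good (l + 1) j) := by
    ext ω
    simp only [attemptSucceeds, Set.mem_inter_iff, Set.mem_iInter, Set.mem_iUnion, exists_prop,
      Finset.mem_range]
    refine and_congr_right fun hk => forall₂_congr fun i hi => exists_congr fun l => ?_
    exact ⟨fun h => ⟨lt_of_mem_attemptAt (hs i hi) h.1 hk, h⟩, fun h => h.2⟩
  rw [this]
  refine (S.measurableSet_attemptAt j k t).inter (Finset.measurableSet_biInter _ fun i _ =>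
    Finset.measurableSet_biUnion _ fun l hl => ?_)
  exact S.ℱ.mono (Nat.succ_le_of_lt (Finset.mem_range.1 hl)) _
    (S.measurableSet_attemptAt_inter_good j i l)

/-- Split by the slot of attempt `k`. On each piece the earlier outcomes are already known, so the
fresh channel factors out as `p j`; the pieces cover almost everything because the number of
attempts is unbounded. -/
lemma measure_attemptSucceeds_inter
    (hN : ∀ᵐ ω ∂P, Tendsto (fun t => S.attempts j t ω) atTop atTop) {k : ℕ} {s : Finset ℕ}
    (hs : ∀ i ∈ s, i < k) :
    P (S.attemptSucceeds j k ∩ ⋂ i ∈ s, S.attemptSucceeds j i)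
      = ENNReal.ofReal (p j) * P (⋂ i ∈ s, S.attemptSucceeds j i) := by
  set B := ⋂ i ∈ s, S.attemptSucceeds j i with hB
  have hm : ∀ t, MeasurableSet[S.ℱ t] (S.attemptAt j k t ∩ B) := fun t =>
    S.measurableSet_attemptAt_inter j hs
  have hd : Pairwise fun t t' => Disjoint (S.attemptAt j k t) (S.attemptAt j k t') :=
    fun t t' htt => Set.disjoint_left.2 fun ω h h' => htt (eq_of_mem_attemptAt h h')
  have e1 : S.attemptSucceeds j k ∩ B = ⋃ t, S.good (t + 1) j ∩ (S.attemptAt j k t ∩ B) := by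
    rw [attemptSucceeds, Set.iUnion_inter]
    refine Set.iUnion_congr fun t => ?_
    rw [Set.inter_comm (S.attemptAt j k t), Set.inter_assoc]
  have e2 : P B = P (⋃ t, S.attemptAt j k t ∩ B) := by
    refine measure_congr ?_
    filter_upwards [hN] with ω hω
    obtain ⟨t, ht⟩ := (hω.eventually_gt_atTop k).exists
    obtain ⟨l, hl⟩ := exists_mem_attemptAt ht
    refine propext ⟨fun h => Set.mem_iUnion.2 ⟨l, hl, h⟩, fun h => ?_⟩
    obtain ⟨l, hl⟩ := Set.mem_iUnion.1 h
    exact hl.2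
  rw [e1, e2, measure_iUnion, measure_iUnion, ← ENNReal.tsum_mul_left]
  · refine tsum_congr fun t => ?_
    rw [(S.good_indep t j _ (hm t)).measure_inter_eq_mul, S.good_prob]
  · exact fun t t' htt => (hd htt).mono Set.inter_subset_left Set.inter_subset_left
  · exact fun t => S.ℱ.le t _ (hm t)
  · exact fun t t' htt => (hd htt).mono (Set.inter_subset_right.trans Set.inter_subset_left)
      (Set.inter_subset_right.trans Set.inter_subset_left)
  · exact fun t => (S.good_measurable t j).inter (S.ℱ.le t _ (hm t))

lemma measure_attemptSucceeds [IsProbabilityMeasure P]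
    (hN : ∀ᵐ ω ∂P, Tendsto (fun t => S.attempts j t ω) atTop atTop) (k : ℕ) :
    P (S.attemptSucceeds j k) = ENNReal.ofReal (p j) := by
  simpa using S.measure_attemptSucceeds_inter j hN (k := k) (s := ∅) (by simp)

/-- The outcomes of the successive attempts of a client are independent. -/
theorem iIndepSet_attemptSucceeds [IsProbabilityMeasure P]
    (hN : ∀ᵐ ω ∂P, Tendsto (fun t => S.attempts j t ω) atTop atTop) :
    iIndepSet (S.attemptSucceeds j) P := by
  refine iIndepSet_of_forall_lt (S.measurableSet_attemptSucceeds j) fun k s hs => ?_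
  rw [S.measure_attemptSucceeds_inter j hN hs, S.measure_attemptSucceeds j hN]

/-- The martingale `M_j` is a time-changed random walk. -/
lemma M_eq_sum_attemptStep (t : ℕ) (ω : Ω) :
    S.M j t ω = ∑ k ∈ Finset.range (S.attempts j t ω),
      attemptStep (p j) (S.attemptSucceeds j k) ω := by
  induction t with
  | zero => simp [attempts, M_zero]
  | succ t ih =>
    rw [M_succ, m, g_eq_mul, u_eq_ite, attempts_succ, ih]
    by_cases h : S.serve (t + 1) ω = some j
    · have hA : ω ∈ S.attemptAt j (S.attempts j t ω) t := ⟨h, rfl⟩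
      have hiff : ω ∈ S.attemptSucceeds j (S.attempts j t ω) ↔ ω ∈ S.good (t + 1) j := by
        refine ⟨fun hω => ?_, fun hω => Set.mem_iUnion.2 ⟨t, hA, hω⟩⟩
        obtain ⟨l, hl, hl'⟩ := Set.mem_iUnion.1 hω
        rwa [eq_of_mem_attemptAt hl hA] at hl'
      simp only [h, if_true, Finset.sum_range_succ, attemptStep, one_mul]
      by_cases h' : ω ∈ S.good (t + 1) j
      · rw [Set.indicator_of_mem h', Set.indicator_of_mem (hiff.2 h')]
      · rw [Set.indicator_of_notMem h', Set.indicator_of_notMem (fun h => h' (hiff.1 h))]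
    · simp [h]

/-- Lower half of the law of the iterated logarithm for `M_j`. -/
theorem ae_frequently_mul_lilScale_le_M [IsProbabilityMeasure P] (hp : 0 < p j) (hp1 : p j < 1)
    {r κ : ℝ} (hr : 0 < r) (hκ : 0 < κ) (hκ1 : κ < 1)
    (hN : ∀ᵐ ω ∂P, Tendsto (fun t : ℕ => (S.attempts j t ω : ℝ) / t) atTop (𝓝 r)) :
    ∀ᵐ ω ∂P, ∃ᶠ t : ℕ in atTop,
      κ * Real.sqrt ((1 - p j) / p j) * Real.sqrt (κ * (κ * r)) * lilScale t ≤ S.M j t ω := by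
  have hv : 0 < (1 - p j) / p j := div_pos (by linarith) hp
  have hev : ∀ᵐ ω ∂P, ∀ᶠ t : ℕ in atTop, κ * r * t ≤ S.attempts j t ω := by
    filter_upwards [hN] with ω hω
    filter_upwards [hω.eventually_const_lt (by nlinarith : κ * r < r), eventually_ge_atTop 1]
      with t ht ht1
    rw [lt_div_iff₀ (by exact_mod_cast ht1)] at ht
    exact ht.le
  have hN' : ∀ᵐ ω ∂P, Tendsto (fun t => S.attempts j t ω) atTop atTop := by
    filter_upwards [hev] with ω hω
    rw [← tendsto_natCast_atTop_iff (R := ℝ)]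
    exact tendsto_atTop_mono' _ hω
      (tendsto_natCast_atTop_atTop.const_mul_atTop (by positivity))
  have hlil := ae_frequently_mul_lilScale_le hp hp1 (S.measurableSet_attemptSucceeds j)
    (S.iIndepSet_attemptSucceeds j hN') (S.measure_attemptSucceeds j hN')
    (a := κ * Real.sqrt ((1 - p j) / p j)) (by nlinarith [Real.sqrt_pos.2 hv])
  filter_upwards [hlil, hev, hN'] with ω h1 h2 h3
  obtain ⟨T, hT⟩ := eventually_atTop.1
    (h2.and (eventually_sqrt_mul_lilScale_le (r := κ * r) (by positivity) hκ hκ1))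
  rw [frequently_atTop]
  intro T'
  -- A walk length `n` at which the walk is large is the attempt count of some slot `t ≥ n`, so `t`
  -- is as late as desired.
  obtain ⟨n, hn, hn'⟩ := frequently_atTop.1 h1 (max T T')
  obtain ⟨t', ht'⟩ := (h3.eventually_ge_atTop n).exists
  obtain ⟨t, rfl⟩ := exists_attempts_eq ht'
  have hle := hn.trans (S.attempts_le j t ω)
  refine ⟨t, (le_max_right _ _).trans hle, ?_⟩
  obtain ⟨a1, a2⟩ := hT t ((le_max_left _ _).trans hle)
  rw [M_eq_sum_attemptStep]
  refine le_trans ?_ hn'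
  rw [mul_assoc]
  exact mul_le_mul_of_nonneg_left (a2 _ a1) (by positivity)

end ScheduledSystem

/-! ### Attempt frequencies under heavy traffic, and the limsup -/

namespace ScheduledSystem

variable {Ω : Type*} [mΩ : MeasurableSpace Ω] {P : Measure Ω} {p : Fin 2 → ℝ}
  (S : ScheduledSystem P p) (j : Fin 2)

lemma M_eq_attempts_sub (t : ℕ) (ω : Ω) :
    S.M j t ω = S.attempts j t ω - (1 / p j) * ∑ l ∈ Finset.Icc 1 t, S.g j l ω := by
  rw [← sum_u_eq_attempts, Finset.mul_sum, ← Finset.sum_sub_distrib]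
  rfl

/-- The trivial bound `attempts ≤ t` permits rate `1` in the upper half for `±M`, so `M` is of order
at most `lilScale`, which is `o(t)`. -/
theorem ae_tendsto_M_div [IsProbabilityMeasure P] (hp : 0 < p j) (hp1 : p j ≤ 1) :
    ∀ᵐ ω ∂P, Tendsto (fun t : ℕ => S.M j t ω / t) atTop (𝓝 0) := by
  have hb : ∀ ω, ∀ᶠ t : ℕ in atTop, (S.attempts j t ω : ℝ) ≤ 1 * t := fun ω =>
    Eventually.of_forall fun t => by
      rw [one_mul]
      exact_mod_cast S.attempts_le j t ω
  filter_upwards [S.ae_eventually_mul_M_le j hp hp1 one_pos (lt_add_one _) abs_one,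
    S.ae_eventually_mul_M_le j hp hp1 one_pos (lt_add_one _) (abs_neg (1 : ℝ) ▸ abs_one)]
    with ω h1 h2
  have h1 := h1 (hb ω)
  have h2 := h2 (hb ω)
  set C := Real.sqrt (1 * ((1 - p j) / p j + 1))
  have t1 : Tendsto (fun t : ℕ => C * (lilScale t / t)) atTop (𝓝 0) := by
    simpa using tendsto_lilScale_div.const_mul C
  have t2 : Tendsto (fun t : ℕ => -(C * (lilScale t / t))) atTop (𝓝 0) := by simpa using t1.neg
  refine tendsto_of_tendsto_of_tendsto_of_le_of_le' t2 t1 ?_ ?_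
  · filter_upwards [h2] with t ht
    rw [← mul_div_assoc, ← neg_div]
    exact div_le_div_of_nonneg_right (by linarith) t.cast_nonneg
  · filter_upwards [h1] with t ht
    rw [← mul_div_assoc]
    exact div_le_div_of_nonneg_right (by linarith) t.cast_nonneg

/-- Attempts equal `M` plus deliveries divided by `p j`, and `M` is negligible on the scale `t`. -/
lemma ae_eventually_lt_attempts_div [IsProbabilityMeasure P] (hp : 0 < p j) (hp1 : p j ≤ 1)
    {q : Fin 2 → ℝ} (hful : S.Fulfils q) :
    ∀ᵐ ω ∂P, ∀ x < q j / p j, ∀ᶠ t : ℕ in atTop, x < (S.attempts j t ω : ℝ) / t := by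
  filter_upwards [S.ae_tendsto_M_div j hp hp1, hful j] with ω h1 h2 x hx
  set y := (x + q j / p j) / 2 with hy
  have hyq : y * p j < q j := by
    rw [← lt_div_iff₀ hp]
    linarith
  have hbdd : IsBoundedUnder (· ≥ ·) atTop
      fun T : ℕ => (∑ t ∈ Finset.Icc 1 T, S.g j t ω) / (T : ℝ) :=
    isBoundedUnder_of ⟨0, fun T => div_nonneg (Finset.sum_nonneg fun t _ =>
      Set.indicator_nonneg (fun _ _ => zero_le_one) _) T.cast_nonneg⟩
  filter_upwards [eventually_lt_of_lt_liminf (hyq.trans_le h2) hbdd,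
    h1.eventually_const_lt (by linarith : x - y < 0)] with t e1 e2
  rw [M_eq_attempts_sub, sub_div, mul_div_assoc] at e2
  have e3 : y < 1 / p j * ((∑ l ∈ Finset.Icc 1 t, S.g j l ω) / t) := by
    rwa [one_div, ← div_eq_inv_mul, lt_div_iff₀ hp]
  linarith

lemma attempts_add_attempts {ω : Ω} (hω : ∀ t, 1 ≤ t → S.serve t ω ≠ none) (t : ℕ) :
    S.attempts 0 t ω + S.attempts 1 t ω = t := by
  induction t with
  | zero => simp [attempts]
  | succ t ih =>
    rw [attempts_succ, attempts_succ]
    obtain ⟨i, hi⟩ := Option.ne_none_iff_exists'.1 (hω (t + 1) (by omega))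
    rw [hi]
    fin_cases i <;> simp <;> omega

/-- Under heavy traffic, each client is attempted in the fraction `q_j / p_j` of the slots. -/
theorem ae_tendsto_attempts_div [IsProbabilityMeasure P] (hp : ∀ j, 0 < p j ∧ p j ≤ 1)
    {q : Fin 2 → ℝ} (hpq : q 0 / p 0 + q 1 / p 1 = 1) (hidle : S.NonIdling)
    (hful : S.Fulfils q) :
    ∀ᵐ ω ∂P, Tendsto (fun t : ℕ => (S.attempts j t ω : ℝ) / t) atTop (𝓝 (q j / p j)) := by
  have hserve : ∀ᵐ ω ∂P, ∀ t, 1 ≤ t → S.serve t ω ≠ none :=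
    ae_all_iff.2 fun t => by
      by_cases ht : 1 ≤ t
      · filter_upwards [hidle t ht] with ω hω _ using hω
      · exact Eventually.of_forall fun _ h => absurd h ht
  filter_upwards [hserve, S.ae_eventually_lt_attempts_div 0 (hp 0).1 (hp 0).2 hful,
    S.ae_eventually_lt_attempts_div 1 (hp 1).1 (hp 1).2 hful] with ω hω h0 h1
  have hsum : ∀ᶠ t : ℕ in atTop,
      (S.attempts 0 t ω : ℝ) / t + (S.attempts 1 t ω : ℝ) / t = 1 := by
    filter_upwards [eventually_ge_atTop 1] with t ht
    have ht0 : (0 : ℝ) < t := by exact_mod_cast ht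
    rw [← add_div, div_eq_one_iff_eq ht0.ne']
    exact_mod_cast S.attempts_add_attempts hω t
  -- Each client's upper bound is the other client's lower bound, the frequencies and the targets
  -- both summing to one.
  rw [tendsto_order]
  fin_cases j
  · refine ⟨h0, fun x hx => ?_⟩
    simp only [Fin.zero_eta] at hx ⊢
    filter_upwards [hsum, h1 (1 - x) (by linarith)] with t e1 e2
    linarith
  · refine ⟨h1, fun x hx => ?_⟩
    simp only [Fin.mk_one] at hx ⊢
    filter_upwards [hsum, h0 (1 - x) (by linarith)] with t e1 e2
    linarith

/-- The law of the iterated logarithm for `M_j`. -/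
theorem ae_limsup_M_div_lilScale [IsProbabilityMeasure P] (hp : 0 < p j) (hp1 : p j ≤ 1)
    {r : ℝ} (hr : 0 ≤ r)
    (hN : ∀ᵐ ω ∂P, Tendsto (fun t : ℕ => (S.attempts j t ω : ℝ) / t) atTop (𝓝 r)) :
    ∀ᵐ ω ∂P, limsup (fun t : ℕ => ((S.M j t ω / lilScale t : ℝ) : EReal)) atTop
      = ((Real.sqrt (r * ((1 - p j) / p j)) : ℝ) : EReal) := by
  have hv : 0 ≤ (1 - p j) / p j := div_nonneg (by linarith) hp.le
  set v := (1 - p j) / p j with hvdef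
  set e : ℕ → ℝ := fun n => 1 / ((n : ℝ) + 1) with he
  have he0 : ∀ n, 0 < e n := fun n => by positivity
  have het : Tendsto e atTop (𝓝 0) := tendsto_one_div_add_atTop_nhds_zero_nat
  -- Both margins are needed: the rate must be positive even if `r = 0`, and `w` must strictly
  -- exceed `v`.
  set b : ℕ → ℝ := fun n => Real.sqrt ((r + e n) * (v + e n)) with hb
  have hbt : Tendsto b atTop (𝓝 (Real.sqrt (r * v))) := by
    have := ((het.const_add r).mul (het.const_add v)).sqrt
    simpa using this
  have hup : ∀ σ : ℝ, |σ| = 1 → ∀ᵐ ω ∂P, ∀ n, ∀ᶠ t : ℕ in atTop,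
      σ * S.M j t ω ≤ b n * lilScale t := by
    intro σ hσ
    refine ae_all_iff.2 fun n => ?_
    filter_upwards [hN, S.ae_eventually_mul_M_le j hp hp1 (add_pos_of_nonneg_of_pos hr (he0 n))
      (lt_add_of_pos_right v (he0 n)) hσ] with ω h1 h2
    refine h2 ?_
    filter_upwards [h1.eventually_lt_const (lt_add_of_pos_right r (he0 n)),
      eventually_ge_atTop 1] with t ht ht1
    rw [div_lt_iff₀ (by exact_mod_cast ht1)] at ht
    exact ht.le
  have hlow : ∀ᵐ ω ∂P, ((Real.sqrt (r * v) : ℝ) : EReal)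
      ≤ limsup (fun t : ℕ => ((S.M j t ω / lilScale t : ℝ) : EReal)) atTop := by
    suffices h : ∃ d : ℕ → ℝ, Tendsto d atTop (𝓝 (Real.sqrt (r * v))) ∧
        ∀ᵐ ω ∂P, ∀ n, ∃ᶠ t : ℕ in atTop, d n * lilScale t ≤ S.M j t ω by
      obtain ⟨d, hd, h⟩ := h
      filter_upwards [h] with ω hω
      refine le_of_tendsto' ((continuous_coe_real_ereal.tendsto _).comp hd) fun n => ?_
      refine le_limsup_of_frequently_le
        (((hω n).and_eventually eventually_lilScale_pos).mono fun t ht => ?_)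
      exact EReal.coe_le_coe_iff.2 ((le_div_iff₀ ht.2).2 ht.1)
    by_cases hrv : 0 < r ∧ p j < 1
    · obtain ⟨hr0, hp1'⟩ := hrv
      -- The shift to `e (n + 1)` avoids `e 0 = 1`, which would give `κ = 0`.
      have hκ : ∀ n, 0 < 1 - e (n + 1) ∧ 1 - e (n + 1) < 1 := fun n => by
        refine ⟨?_, by linarith [he0 (n + 1)]⟩
        rw [sub_pos, he]
        simp only
        rw [div_lt_one (by positivity)]
        push_cast
        linarith [n.cast_nonneg (α := ℝ)]
      refine ⟨fun n => (1 - e (n + 1)) * Real.sqrt v *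
        Real.sqrt ((1 - e (n + 1)) * ((1 - e (n + 1)) * r)), ?_, ae_all_iff.2 fun n =>
        S.ae_frequently_mul_lilScale_le_M j hp hp1' hr0 (hκ n).1 (hκ n).2 hN⟩
      have h1 : Tendsto (fun n => 1 - e (n + 1)) atTop (𝓝 1) := by
        simpa using (het.comp (tendsto_add_atTop_nat 1)).const_sub 1
      have h2 := (h1.mul_const (Real.sqrt v)).mul ((h1.mul (h1.mul_const r)).sqrt)
      rw [Real.sqrt_mul hr, mul_comm]
      simpa using h2
    -- Degenerate case: the limit is `0`, and the upper half for `-M` gives `M ≥ -b n * lilScale`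
    -- eventually, with `b n → 0`.
    · have hrv0 : r * v = 0 := by
        rcases not_and_or.1 hrv with h | h
        · rw [le_antisymm (not_lt.1 h) hr, zero_mul]
        · rw [hvdef, le_antisymm hp1 (not_lt.1 h)]
          simp
      refine ⟨fun n => -b n, ?_, ?_⟩
      · have := hbt.neg
        rw [hrv0, Real.sqrt_zero, neg_zero] at this
        rwa [hrv0, Real.sqrt_zero]
      · filter_upwards [hup (-1) (by simp)] with ω hω n
        refine ((hω n).mono fun t ht => ?_).frequently
        linarith
  filter_upwards [hlow, hup 1 abs_one] with ω h1 h2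
  refine le_antisymm ?_ h1
  refine ge_of_tendsto' ((continuous_coe_real_ereal.tendsto _).comp hbt) fun n => ?_
  refine limsup_le_of_le (h := ?_)
  filter_upwards [h2 n, eventually_lilScale_pos] with t ht ht0
  rw [one_mul] at ht
  exact EReal.coe_le_coe_iff.2 ((div_le_iff₀ ht0).2 ht)

theorem ae_condVarSum_eq [IsProbabilityMeasure P] (hp : 0 < p j) (T : ℕ) :
    ∀ᵐ ω ∂P, S.condVarSum j T ω = ∑ t ∈ Finset.Icc 1 T, S.u j t ω * ((1 - p j) / p j) := by
  have h : ∀ᵐ ω ∂P, ∀ t ∈ Finset.Icc 1 T, (P[fun ω' => S.m j t ω' ^ 2 | S.ℱ (t - 1)]) ω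
      = S.u j t ω * ((1 - p j) / p j) :=
    (ae_ball_iff (Finset.Icc 1 T).countable_toSet).2 fun t ht =>
      S.condExp_sq_m j hp (Finset.mem_Icc.1 ht).1
  filter_upwards [h] with ω hω
  exact Finset.sum_congr rfl hω

end ScheduledSystem

theorem mainTheorem8 {Ω : Type*} [mΩ : MeasurableSpace Ω] (P : Measure Ω) [IsProbabilityMeasure P]
    (p q : Fin 2 → ℝ) (hp : ∀ j, 0 < p j ∧ p j ≤ 1) (hq : ∀ j, 0 ≤ q j)
    (hpq : q 0 / p 0 + q 1 / p 1 = 1)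
    (S : ScheduledSystem P p) (hidle : S.NonIdling) (hful : S.Fulfils q)
    (j : Fin 2) (v c : ℝ) (hv : v = (1 - p j) / p j) (hc : c = q j * (1 - p j) / p j ^ 2) :
    -- `M_j` is a martingale
    Martingale (S.M j) S.ℱ P ∧
    -- (i)
    (∀ t : ℕ, 1 ≤ t →
      P[fun ω => S.m j t ω ^ 2 | S.ℱ (t - 1)] =ᵐ[P] fun ω => S.u j t ω * v) ∧
    -- (ii)
    (∀ T : ℕ, ∀ᵐ ω ∂P, S.condVarSum j T ω = ∑ t ∈ Finset.Icc 1 T, S.u j t ω * v) ∧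
    -- (iii)
    (q j / p j * v = c ∧
      ∀ᵐ ω ∂P, Tendsto (fun T : ℕ => S.condVarSum j T ω / (T : ℝ)) atTop (𝓝 c)) ∧
    -- (iv)
    (∀ᵐ ω ∂P, Tendsto (fun T : ℕ => Real.sqrt (S.condVarSum j T ω) / Real.sqrt (T : ℝ)) atTop
      (𝓝 (Real.sqrt c))) ∧
    -- the law of the iterated logarithm
    (∀ᵐ ω ∂P, limsup (fun t : ℕ => ((S.M j t ω / lilScale t : ℝ) : EReal)) atTop
      = ((Real.sqrt c : ℝ) : EReal)) := by
  have hp0 := (hp j).1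
  have hcv : q j / p j * v = c := by
    rw [hv, hc]
    field_simp
  have hN := S.ae_tendsto_attempts_div j hp hpq hidle hful
  have hsum : ∀ T : ℕ, ∀ᵐ ω ∂P, S.condVarSum j T ω = ∑ t ∈ Finset.Icc 1 T, S.u j t ω * v := by
    rw [hv]
    exact S.ae_condVarSum_eq j hp0
  have hlim : ∀ᵐ ω ∂P,
      Tendsto (fun T : ℕ => S.condVarSum j T ω / (T : ℝ)) atTop (𝓝 c) := by
    filter_upwards [ae_all_iff.2 hsum, hN] with ω h1 h2
    rw [← hcv]
    refine (h2.mul_const v).congr fun T => ?_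
    rw [h1 T, ← Finset.sum_mul, S.sum_u_eq_attempts]
    ring
  refine ⟨S.martingale_M j hp0, fun t ht => ?_, hsum, ⟨hcv, hlim⟩, ?_, ?_⟩
  · rw [hv]
    exact S.condExp_sq_m j hp0 ht
  · filter_upwards [hlim] with ω hω
    refine hω.sqrt.congr fun T => ?_
    rw [Real.sqrt_div' _ T.cast_nonneg]
  · rw [← hcv, hv]
    exact S.ae_limsup_M_div_lilScale j hp0 (hp j).2 (div_nonneg (hq j) hp0.le) hN
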